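/- Let $1\le p<\infty$, $\beta\in\mathbb R$ with $\beta\ne p$, and let $C_D,C_H\ge 0$ be constants. Then there is $\varepsilon>0$, depending only on $p,\beta,C_D,C_H$, such that the following holds. Let $X=(X,d)$ be a complete metric space and $\mu$ a Borel measure on $X$ such that $0<\mu(B)<\infty$ for every closed ball $B=B(x,r)=\{y:d(x,y)\le r\}$, $r>0$, and $\mu(B(x,2r))\le C_D\,\mu(B(x,r))$ for all $x\in X$, $r>0$. Let $\Omega\subset X$ be open, $\Omega^c=X\setminus\Omega$, $d_\Omega(x)=\operatorname{dist}(x,\Omega^c)$, and assume that $\Omega$ admits a $(p,\beta)$-Hardy inequality with constant $C_H$: \[\int_\Omega |u|^p\,d_\Omega^{\beta-p}\,d\mu\le C_H\int_\Omega g^p\,d_\Omega^{\beta}\,d\mu\] for all Lipschitz functions $u$ with compact support in $\Omega$ and all upper gradients $g$ of $u$ (Borel functions $g:X\to[0,\infty]$ with $|u(y)-u(x)|\le\int_\gamma g\,ds$ for every compact rectifiable curve $\gamma$ with endpoints $x,y$). Then \[\operatorname{codim}_H(\Omega^c)<p-\beta-\varepsilon\quad\text{or}\quad\underline{\operatorname{codim}}_A(\Omega^c)>p-\beta+\varepsilon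 .\] In particular, $\operatorname{codim}_H(\Omega^c)<p-\beta$ or $\underline{\operatorname{codim}}_A(\Omega^c)>p-\beta$. Here the codimensions take values in $[0,\infty]$. For a fixed $R\in(0,\infty)$ (every choice is allowed, with the same $\varepsilon$), $\operatorname{codim}_H(E)$ is the supremum of all $q\ge0$ with $\mathcal H^{\mu,q}_R(E)=0$, and $0$ if there is no such $q$, where $\mathcal H^{\mu,q}_R(E)$ is the infimum of $\sum_k r_k^{-q}\mu(B(x_k,r_k))$ over all countable covers of $E$ by closed balls $B(x_k,r_k)$ with $0<r_k\le R$. The lower Assouad codimension $\underline{\operatorname{codim}}_A(E)$ is the supremum of all $t\ge0$ for which there is a constant $C$ with \[\frac{\mu(E_r\cap B(x,R))}{\mu(B(x,R))}\le C\Bigl(\frac rR\Bigr)^t\quad\text{for all }x\in E\text{ and all }0<r<R<\operatorname{diam}(E),\] where $E_r=\{x:\operatorname{dist}(x,E)<r\}$; if $\operatorname{diam}(E)=0$, the bound $\operatorname{diam}(E)$ is replaced by $\operatorname{diam}(X)$. -/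

import Mathlib

open MeasureTheory Set Metric
open scoped NNReal ENNReal

/-- The measure `μ` gives every closed ball of positive radius positive and finite measure and is
doubling with constant `C`: `μ (B(x, 2r)) ≤ C μ (B(x, r))` for all `x` and all `r > 0`. -/
structure IsDoublingWith {X : Type*} [MetricSpace X] [MeasurableSpace X]
    (μ : Measure X) (C : ℝ≥0) : Prop where
  pos : ∀ (x : X) (r : ℝ), 0 < r → 0 < μ (closedBall x r)
  lt_top : ∀ (x : X) (r : ℝ), 0 < r → μ (closedBall x r) < ∞
  doubling : ∀ (x : X) (r : ℝ), 0 < r → μ (closedBall x (2 * r)) ≤ C * μ (closedBall x r)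

/-- The Borel function `g : X → [0, ∞]` is an upper gradient of the real-valued function `u`:
`|u(y) - u(x)| ≤ ∫_γ g ds` for every compact rectifiable curve `γ` with endpoints `x` and `y`.
Compact rectifiable curves are given by their arc-length parametrizations `γ : [0, ℓ] → X`,
for which `∫_γ g ds = ∫_0^ℓ g (γ t) dt`. -/
structure IsUpperGradient {X : Type*} [MetricSpace X] [MeasurableSpace X]
    (u : X → ℝ) (g : X → ℝ≥0∞) : Prop where
  measurable : Measurable g
  le_integral : ∀ (l : ℝ) (γ : ℝ → X), 0 ≤ l → HasUnitSpeedOn γ (Icc 0 l) →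
    ENNReal.ofReal |u (γ l) - u (γ 0)| ≤ ∫⁻ t in Icc 0 l, g (γ t)

/-- `Lip₀(Ω)`: Lipschitz functions with compact support in the open set `Ω`. Such a function on
`Ω` is identified with its extension by zero to `X`, which is again Lipschitz. -/
structure IsLipZero {X : Type*} [MetricSpace X] (Ω : Set X) (u : X → ℝ) : Prop where
  lipschitz : ∃ L : ℝ≥0, LipschitzWith L u
  compact_support : HasCompactSupport u
  support_subset : tsupport u ⊆ Ω

/-- `Ω` admits a `(p, β)`-Hardy inequality with constant `C`. The weight is a power of
`d_Ω(x) = dist(x, Ωᶜ)`, computed in `[0, ∞]`. -/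
def HardyInequalityWith {X : Type*} [MetricSpace X] [MeasurableSpace X]
    (μ : Measure X) (Ω : Set X) (p β : ℝ) (C : ℝ≥0) : Prop :=
  ∀ (u : X → ℝ) (g : X → ℝ≥0∞), IsLipZero Ω u → IsUpperGradient u g →
    ∫⁻ x in Ω, ENNReal.ofReal |u x| ^ p * infEDist x Ωᶜ ^ (β - p) ∂μ
      ≤ C * ∫⁻ x in Ω, g x ^ p * infEDist x Ωᶜ ^ β ∂μ

/-- The Hausdorff content of codimension `q` at scale `R`: the infimum of
`∑ rad(B)^(-q) μ(B)` over the countable covers of `E` by closed balls of radius at most `R`.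
A ball is recorded by its centre and its radius. -/
noncomputable def hausdorffContentCodim {X : Type*} [MetricSpace X] [MeasurableSpace X]
    (μ : Measure X) (R q : ℝ) (E : Set X) : ℝ≥0∞ :=
  ⨅ (S : Set (X × ℝ)) (_ : S.Countable) (_ : ∀ b ∈ S, 0 < b.2 ∧ b.2 ≤ R)
    (_ : E ⊆ ⋃ b ∈ S, closedBall b.1 b.2),
    ∑' b : S, ENNReal.ofReal b.1.2 ^ (-q) * μ (closedBall b.1.1 b.1.2)

/-- The Hausdorff codimension of `E`, computed with the contents at scale `R`, where
`0 < R < ∞`. For a doubling measure it does not depend on `R`. The supremum is taken in `[0, ∞]`,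
so it is `0` if no `q ≥ 0` qualifies, in particular if `μ E > 0`. -/
noncomputable def hausdorffCodim {X : Type*} [MetricSpace X] [MeasurableSpace X]
    (μ : Measure X) (R : ℝ) (E : Set X) : ℝ≥0∞ :=
  ⨆ (q : ℝ≥0) (_ : hausdorffContentCodim μ R q E = 0), (q : ℝ≥0∞)

open Classical in
/-- The upper bound for the radii in the definition of the Assouad codimension of `E`: the diameter
of `E`, replaced by that of the whole space if `E` has at most one point. -/
noncomputable def assouadScale {X : Type*} [MetricSpace X] (E : Set X) : ℝ≥0∞ :=
  if ediam E = 0 then ediam (univ : Set X) else ediam E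

/-- The lower Assouad codimension of `E`: the supremum, in `[0, ∞]`, of all `t ≥ 0` for which
there is `C` with `μ(E_r ∩ B(x, R)) / μ(B(x, R)) ≤ C (r / R)^t` for all `x ∈ E` and all
`0 < r < R < diam E`, where `E_r` is the open `r`-neighbourhood of `E`. -/
noncomputable def lowerAssouadCodim {X : Type*} [MetricSpace X] [MeasurableSpace X]
    (μ : Measure X) (E : Set X) : ℝ≥0∞ :=
  ⨆ (t : ℝ≥0) (_ : ∃ C : ℝ≥0, ∀ x ∈ E, ∀ r R : ℝ, 0 < r → r < R →
      ENNReal.ofReal R < assouadScale E →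
      μ (thickening r E ∩ closedBall x R) / μ (closedBall x R)
        ≤ C * ENNReal.ofReal (r / R) ^ (t : ℝ)), (t : ℝ≥0∞)

/-! If `β > p` the second alternative is trivial, since `p - β + ε` is negative for small `ε`. So
let `s = p - β > 0`, write `d` for the distance to `Ωᶜ`, `P = p + s`, `δ = a * P` with `a` small,
and suppose that the codimension `s - δ` content of `Ωᶜ` vanishes. The aim is codimension `s + δ`
decay of the neighbourhoods of `Ωᶜ`; then `ε = δ / 2` works.

Inserting `v ^ (P / p)` into the Hardy inequality turns it into an inequality with exponent `P` and
weights `d ^ (-s)`, `d ^ p`. If the gradient of `v` is at most `a * v / d + h`, the first term is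
absorbed for small `a`, and only `h` remains on the right (`HardyInequalityWith.lintegral_rpow_le`).

The test function (`exists_testFunction`) is `d ^ (-a)`, which has exactly such a gradient, times a
cutoff to `B(x, 2R)` and a cutoff vanishing on balls that cover `Ωᶜ` there. The left side controls
`r ^ (-(s + δ))` times the measure of a layer `t ≤ d < r`; the outer cutoff contributes `R ^ (-(s +
δ)) * μ (B(x, 2R))`, which is the desired bound. With the plain power, the cover would contribute a
content of codimension `s + δ`, about which nothing is known. Below level `t` the power is therefore
bent down to a multiple of `d ^ a` (`peakWeight`). The cover then contributes a content of
codimension `s - δ`, times a constant depending on `t`. With `t` fixed this is made arbitrarily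
small by the choice of cover (`HardyInequalityWith.measure_layer_le`), and only afterwards does `t`
tend to `0`. -/

open Filter Topology

/-! ### Doubling measures: properness and finiteness on compact sets. -/

section Doubling

variable {X : Type*} [MetricSpace X] [MeasurableSpace X] {μ : Measure X} {C : ℝ≥0}

theorem IsDoublingWith.measure_closedBall_two_pow_mul_le (h : IsDoublingWith μ C) (x : X) {r : ℝ}
    (hr : 0 < r) (n : ℕ) :
    μ (closedBall x (2 ^ n * r)) ≤ (C : ℝ≥0∞) ^ n * μ (closedBall x r) := by
  induction n with
  | zero => simp
  | succ n ih =>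
    calc μ (closedBall x (2 ^ (n + 1) * r)) = μ (closedBall x (2 * (2 ^ n * r))) := by ring_nf
      _ ≤ C * μ (closedBall x (2 ^ n * r)) := h.doubling x _ (by positivity)
      _ ≤ C * ((C : ℝ≥0∞) ^ n * μ (closedBall x r)) := by gcongr
      _ = (C : ℝ≥0∞) ^ (n + 1) * μ (closedBall x r) := by ring

theorem IsDoublingWith.measure_closedBall_three_mul_le (h : IsDoublingWith μ C) (x : X) {r : ℝ}
    (hr : 0 < r) : μ (closedBall x (3 * r)) ≤ (C : ℝ≥0∞) ^ 2 * μ (closedBall x r) :=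
  (measure_mono (closedBall_subset_closedBall (by linarith))).trans
    (h.measure_closedBall_two_pow_mul_le x hr 2)

/-- The balls of radius `r` with centres in a fixed ball have measure bounded from below. -/
theorem IsDoublingWith.exists_pos_le_measure_closedBall (h : IsDoublingWith μ C) (x : X) (R : ℝ)
    {r : ℝ} (hr : 0 < r) :
    ∃ c : ℝ≥0∞, 0 < c ∧ ∀ y ∈ closedBall x R, c ≤ μ (closedBall y r) := by
  -- With this `n`, every ball `B(y, 2 ^ n * r)` centred in `B(x, R)` contains `B(x, 1)`.
  obtain ⟨n, hn⟩ := pow_unbounded_of_one_lt ((|R| + 1) * 2 / r) (one_lt_two : (1 : ℝ) < 2)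
  have hn' : (|R| + 1) * 2 ≤ 2 ^ n * r := by
    rw [div_lt_iff₀ hr] at hn
    exact hn.le
  refine ⟨μ (closedBall x 1) / (C : ℝ≥0∞) ^ n, ?_, fun y hy => ?_⟩
  · exact ENNReal.div_pos (h.pos x 1 one_pos).ne' (ENNReal.pow_ne_top ENNReal.coe_ne_top)
  · refine ENNReal.div_le_of_le_mul' (le_trans (measure_mono fun z hz => ?_)
      (h.measure_closedBall_two_pow_mul_le y hr n))
    rw [mem_closedBall] at hy hz ⊢
    have := dist_triangle z x y
    rw [dist_comm x y] at this
    linarith [le_abs_self R, abs_nonneg R]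

/-- Balls of radius `ε / 2` about the points are disjoint, lie in one ball of finite measure, and
have measure bounded from below. -/
theorem IsDoublingWith.finite_of_isSeparated [BorelSpace X] (h : IsDoublingWith μ C) {x : X}
    {R : ℝ} {N : Set X} (hN : N ⊆ closedBall x R) {ε : ℝ≥0} (hε : 0 < ε) (hs : IsSeparated ε N) :
    N.Finite := by
  obtain ⟨c, hc, hle⟩ := h.exists_pos_le_measure_closedBall x R (r := ε / 2) (by positivity)
  have hfin := Measure.finite_const_le_meas_of_disjoint_iUnion μ hc
    (As := fun y : N => closedBall (y : X) (ε / 2)) (fun _ => measurableSet_closedBall) ?_ ?_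
  · have : {i : N | c ≤ μ (closedBall (i : X) (ε / 2))} = univ :=
      eq_univ_of_forall fun y => hle y (hN y.2)
    rw [this] at hfin
    exact finite_coe_iff.1 (finite_univ_iff.1 hfin)
  · intro y z hyz
    have h1 : (ε : ℝ≥0∞) < edist (y : X) z := hs y.2 z.2 (Subtype.coe_injective.ne hyz)
    refine closedBall_disjoint_closedBall ?_
    rw [edist_nndist] at h1
    have h2 : (ε : ℝ) < dist (y : X) z := by
      rw [← coe_nndist]
      exact_mod_cast h1
    linarith
  · refine ne_top_of_le_ne_top (h.lt_top x (|R| + ε) (by positivity)).ne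
      (measure_mono (iUnion_subset fun y => closedBall_subset_closedBall' ?_))
    have := mem_closedBall.1 (hN y.2)
    have := le_abs_self R
    have : (0 : ℝ) < ε := hε
    linarith

theorem IsDoublingWith.properSpace [BorelSpace X] [CompleteSpace X] (h : IsDoublingWith μ C) :
    ProperSpace X := by
  refine ⟨fun x R => TotallyBounded.isCompact_of_isClosed
    (Metric.totallyBounded_iff.2 fun ε hε => ?_) isClosed_closedBall⟩
  lift ε to ℝ≥0 using hε.le
  obtain ⟨N, hN⟩ := zorn_subset {N | N ⊆ closedBall x R ∧ IsSeparated ((ε / 2 : ℝ≥0) : ℝ≥0∞) N}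
    (fun c hc hchain => ⟨⋃₀ c, ⟨sUnion_subset fun s hs => (hc hs).1,
      (pairwise_sUnion hchain.directedOn).2 fun s hs => (hc hs).2⟩,
      fun s hs => subset_sUnion_of_mem hs⟩)
  have hε' : (0 : ℝ) < ε := hε
  refine ⟨N, h.finite_of_isSeparated hN.prop.1 (ε := ε / 2) (half_pos hε) hN.prop.2, ?_⟩
  refine (IsCover.subset_iUnion_closedBall (IsCover.of_maximal_isSeparated hN)).trans
    (iUnion₂_mono fun y _ => closedBall_subset_ball ?_)
  push_cast
  linarith

theorem IsDoublingWith.isFiniteMeasureOnCompacts (h : IsDoublingWith μ C) :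
    IsFiniteMeasureOnCompacts μ := by
  refine ⟨fun K hK => ?_⟩
  rcases K.eq_empty_or_nonempty with rfl | ⟨x, -⟩
  · simp
  · obtain ⟨r, hr, hKr⟩ := hK.isBounded.subset_closedBall_lt 0 x
    exact (measure_mono hKr).trans_lt (h.lt_top x r hr)

end Doubling

/-! ### Upper gradients through almost everywhere derivatives along curves, which obey the product
and chain rules. -/

section CurveBound

theorem HasUnitSpeedOn.dist_le {X : Type*} [PseudoMetricSpace X] {γ : ℝ → X} {s : Set ℝ}
    (hγ : HasUnitSpeedOn γ s) {x y : ℝ} (hx : x ∈ s) (hy : y ∈ s) :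
    dist (γ x) (γ y) ≤ |x - y| := by
  wlog hxy : x ≤ y generalizing x y
  · rw [dist_comm, abs_sub_comm]
    exact this hy hx (le_of_not_ge hxy)
  have h1 := eVariationOn.edist_le γ (s := s ∩ Icc x y) ⟨hx, le_rfl, hxy⟩ ⟨hy, hxy, le_rfl⟩
  rw [hγ hx hy, edist_dist, ENNReal.ofReal_le_ofReal_iff (by simpa using hxy)] at h1
  rw [abs_sub_comm, abs_of_nonneg (sub_nonneg.2 hxy)]
  simpa using h1

/-- Along almost every point of every unit speed curve, the derivative of `u` is at most `g`. -/
def CurveBound {X : Type*} [MetricSpace X] (u g : X → ℝ) : Prop :=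
  ∀ (l : ℝ) (γ : ℝ → X), HasUnitSpeedOn γ (Icc 0 l) →
    ∀ᵐ t : ℝ, t ∈ Ioo 0 l → |deriv (u ∘ γ) t| ≤ g (γ t)

variable {X : Type*} [MetricSpace X] {u u₁ u₂ g g₁ g₂ : X → ℝ} {l : ℝ} {γ : ℝ → X} {K K₁ K₂ : ℝ≥0}

theorem HasUnitSpeedOn.lipschitzOnWith_comp (hγ : HasUnitSpeedOn γ (Icc 0 l))
    (hu : LipschitzWith K u) : LipschitzOnWith K (u ∘ γ) (Icc 0 l) :=
  LipschitzOnWith.of_dist_le_mul fun x hx y hy => (hu.dist_le_mul _ _).trans <| by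
    gcongr
    exact (hγ.dist_le hx hy).trans_eq (Real.dist_eq x y).symm

theorem HasUnitSpeedOn.continuousAt {t : ℝ} (hγ : HasUnitSpeedOn γ (Icc 0 l)) (ht : t ∈ Ioo 0 l) :
    ContinuousAt γ t := by
  refine (LipschitzOnWith.continuousOn (K := 1) (LipschitzOnWith.of_dist_le_mul
    fun x hx y hy => ?_)).continuousAt (Icc_mem_nhds ht.1 ht.2)
  simpa [Real.dist_eq] using hγ.dist_le hx hy

theorem HasUnitSpeedOn.ae_differentiableAt (hγ : HasUnitSpeedOn γ (Icc 0 l))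
    (hu : LipschitzWith K u) : ∀ᵐ t : ℝ, t ∈ Ioo 0 l → DifferentiableAt ℝ (u ∘ γ) t := by
  filter_upwards [(hγ.lipschitzOnWith_comp hu).ae_differentiableWithinAt_of_mem_real] with t h ht
  exact (h (Ioo_subset_Icc_self ht)).differentiableAt (Icc_mem_nhds ht.1 ht.2)

theorem CurveBound.mono (h : CurveBound u g₁) (hle : ∀ x, g₁ x ≤ g₂ x) : CurveBound u g₂ :=
  fun l γ hγ => by
    filter_upwards [h l γ hγ] with t h ht
    exact (h ht).trans (hle _)

theorem LipschitzWith.curveBound (hu : LipschitzWith K u) : CurveBound u fun _ => K := by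
  refine fun l γ hγ => Eventually.of_forall fun t ht => ?_
  exact norm_deriv_le_of_lipschitzOn (Icc_mem_nhds ht.1 ht.2) (hγ.lipschitzOnWith_comp hu)

/-- A curve bound can be replaced by zero on an open set where the function is constant. -/
theorem CurveBound.indicator_compl (h : CurveBound u g) {O : Set X} (hO : IsOpen O) {c : ℝ}
    (hc : ∀ x ∈ O, u x = c) : CurveBound u (Oᶜ.indicator g) := by
  intro l γ hγ
  filter_upwards [h l γ hγ] with t h ht
  by_cases hm : γ t ∈ O
  · have h1 : u ∘ γ =ᶠ[𝓝 t] fun _ => c :=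
      ((hγ.continuousAt ht).eventually (hO.mem_nhds hm)).mono fun s hs => hc _ hs
    rw [h1.deriv_eq]
    simp [hm]
  · rw [indicator_of_mem (show γ t ∈ Oᶜ from hm)]
    exact h ht

/-- At a contact point the difference has a minimum. For `CurveBound.min` this makes the derivative
of the minimum agree with that of whichever function attains it, ties included. -/
theorem HasDerivAt.eq_of_le {f F : ℝ → ℝ} {a b t : ℝ} (hf : HasDerivAt f a t)
    (hF : HasDerivAt F b t) (hle : ∀ s, F s ≤ f s) (heq : F t = f t) : b = a := by
  have hmin : IsLocalMin (fun s => f s - F s) t :=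
    Eventually.of_forall fun s => by simp [heq, hle s]
  have := hmin.hasDerivAt_eq_zero (hf.sub hF)
  linarith

theorem CurveBound.min (h₁ : CurveBound u₁ g₁) (h₂ : CurveBound u₂ g₂) (hu₁ : LipschitzWith K₁ u₁)
    (hu₂ : LipschitzWith K₂ u₂) : CurveBound (fun x => min (u₁ x) (u₂ x))
      (fun x => if u₁ x ≤ u₂ x then g₁ x else g₂ x) := by
  intro l γ hγ
  filter_upwards [h₁ l γ hγ, h₂ l γ hγ, hγ.ae_differentiableAt hu₁, hγ.ae_differentiableAt hu₂,
    hγ.ae_differentiableAt (hu₁.min hu₂)] with t h₁ h₂ d₁ d₂ d ht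
  split_ifs with hle
  · rw [(d₁ ht).hasDerivAt.eq_of_le (d ht).hasDerivAt (fun s => min_le_left _ _)
      (min_eq_left hle)]
    exact h₁ ht
  · rw [(d₂ ht).hasDerivAt.eq_of_le (d ht).hasDerivAt (fun s => min_le_right _ _)
      (min_eq_right (le_of_not_ge hle))]
    exact h₂ ht

theorem CurveBound.mul (h₁ : CurveBound u₁ g₁) (h₂ : CurveBound u₂ g₂) (hu₁ : LipschitzWith K₁ u₁)
    (hu₂ : LipschitzWith K₂ u₂) : CurveBound (fun x => u₁ x * u₂ x)
      (fun x => |u₁ x| * g₂ x + |u₂ x| * g₁ x) := by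
  intro l γ hγ
  filter_upwards [h₁ l γ hγ, h₂ l γ hγ, hγ.ae_differentiableAt hu₁, hγ.ae_differentiableAt hu₂]
    with t h₁ h₂ d₁ d₂ ht
  have hd := (d₁ ht).hasDerivAt.mul (d₂ ht).hasDerivAt
  have heq : (fun x => u₁ x * u₂ x) ∘ γ = u₁ ∘ γ * u₂ ∘ γ := rfl
  rw [heq, hd.deriv]
  refine (abs_add_le _ _).trans ?_
  rw [abs_mul, abs_mul, add_comm]
  simp only [Function.comp_apply]
  rw [mul_comm |deriv _ _| |u₂ _|]
  gcongr
  · exact h₂ ht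
  · exact h₁ ht

theorem CurveBound.comp (h : CurveBound u g) (hu : LipschitzWith K u) {f f' : ℝ → ℝ}
    (hf : ∀ x, HasDerivAt f (f' (u x)) (u x)) :
    CurveBound (fun x => f (u x)) (fun x => |f' (u x)| * g x) := by
  intro l γ hγ
  filter_upwards [h l γ hγ, hγ.ae_differentiableAt hu] with t h d ht
  have hd := HasDerivAt.comp t (hf (γ t)) (d ht).hasDerivAt
  have heq : (fun x => f (u x)) ∘ γ = f ∘ (u ∘ γ) := rfl
  rw [heq, hd.deriv, abs_mul]
  gcongr
  exact h ht

/-- Along a unit speed curve a Lipschitz function is absolutely continuous, so the fundamental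
theorem of calculus applies. -/
theorem CurveBound.isUpperGradient [MeasurableSpace X] (h : CurveBound u g)
    (hu : LipschitzWith K u) (hg : Measurable g) :
    IsUpperGradient u fun x => ENNReal.ofReal (g x) := by
  refine ⟨hg.ennreal_ofReal, fun l γ hl hγ => ?_⟩
  have hac : AbsolutelyContinuousOnInterval (u ∘ γ) 0 l :=
    LipschitzOnWith.absolutelyContinuousOnInterval
      (by rw [uIcc_of_le hl]; exact hγ.lipschitzOnWith_comp hu)
  have hftc := hac.integral_deriv_eq_sub
  simp only [Function.comp_apply] at hftc
  rw [← hftc]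
  have h1 : ENNReal.ofReal |∫ t in (0 : ℝ)..l, deriv (u ∘ γ) t|
      ≤ ∫⁻ t in Ioc 0 l, ENNReal.ofReal |deriv (u ∘ γ) t| := by
    rw [intervalIntegral.integral_of_le hl]
    have := enorm_integral_le_lintegral_enorm (μ := volume.restrict (Ioc 0 l)) (deriv (u ∘ γ))
    simpa only [← ofReal_norm, Real.norm_eq_abs] using this
  refine h1.trans ?_
  rw [Measure.restrict_congr_set Ioo_ae_eq_Ioc.symm, ← Measure.restrict_congr_set Ioo_ae_eq_Icc]
  refine lintegral_mono_ae ?_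
  rw [ae_restrict_iff' measurableSet_Ioo]
  filter_upwards [h l γ hγ] with t h ht
  exact ENNReal.ofReal_le_ofReal (h ht)

end CurveBound

/-! ### Raising the exponent in the Hardy inequality. -/

section HardyPower

/-- Whichever of `a * V` and `H` is larger dominates the sum. The coefficient of `V ^ (p + s)` is
small with `a`, which permits absorption. -/
theorem Real.rpow_mul_add_rpow_le {p s a V H : ℝ} (hp : 0 ≤ p) (hs : 0 ≤ s) (ha : 0 < a)
    (hV : 0 ≤ V) (hH : 0 ≤ H) :
    V ^ s * (a * V + H) ^ p ≤ (2 * a) ^ p * V ^ (p + s) + 2 ^ p * a ^ (-s) * H ^ (p + s) := by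
  rcases le_total H (a * V) with h | h
  · calc V ^ s * (a * V + H) ^ p ≤ V ^ s * (2 * a * V) ^ p := by
          gcongr
          linarith
      _ = (2 * a) ^ p * V ^ (p + s) := by
          rw [Real.mul_rpow (by positivity) hV, Real.rpow_add_of_nonneg hV hp hs]
          ring
      _ ≤ _ := le_add_of_nonneg_right (by positivity)
  · calc V ^ s * (a * V + H) ^ p ≤ (H / a) ^ s * (2 * H) ^ p := by
          gcongr
          · rw [le_div_iff₀ ha]
            linarith
          · linarith
      _ = 2 ^ p * a ^ (-s) * H ^ (p + s) := by
          rw [Real.mul_rpow (by positivity) hH, Real.div_rpow hH ha.le,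
            Real.rpow_add_of_nonneg hH hp hs, Real.rpow_neg ha.le]
          field_simp
      _ ≤ _ := le_add_of_nonneg_left (by positivity)

theorem ENNReal.le_two_mul_of_le_half_add {x y : ℝ≥0∞} (hx : x ≠ ∞)
    (h : x ≤ ENNReal.ofReal (1 / 2) * x + y) : x ≤ 2 * y := by
  have h2 : ENNReal.ofReal (1 / 2) = 2⁻¹ := by
    rw [one_div, ENNReal.ofReal_inv_of_pos two_pos]
    simp
  rw [h2] at h
  have h3 : 2⁻¹ * x + 2⁻¹ * x ≤ 2⁻¹ * x + y := by
    rwa [← add_mul, ENNReal.inv_two_add_inv_two, one_mul]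
  rw [ENNReal.add_le_add_iff_left (ENNReal.mul_ne_top (by simp) hx)] at h3
  calc x = 2 * (2⁻¹ * x) := by
        rw [← mul_assoc, ENNReal.mul_inv_cancel two_ne_zero ENNReal.ofNat_ne_top, one_mul]
    _ ≤ 2 * y := by gcongr

variable {X : Type*} [MetricSpace X]

theorem LipschitzWith.exists_rpow_const {v : X → ℝ} {K : ℝ≥0} (hv : LipschitzWith K v) {M : ℝ}
    (hv0 : ∀ x, 0 ≤ v x) (hvM : ∀ x, v x ≤ M) {q : ℝ} (hq : 1 ≤ q) :
    ∃ L : ℝ≥0, LipschitzWith L fun x => v x ^ q := by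
  obtain ⟨L, hL⟩ := ContDiffOn.exists_lipschitzOnWith (s := Icc 0 M) (n := 1)
    ((Real.contDiff_rpow_const_of_le (p := q) (n := 1) (by simpa using hq)).contDiffOn)
    one_ne_zero (convex_Icc 0 M) isCompact_Icc
  refine ⟨L * K, ?_⟩
  rw [← lipschitzOnWith_univ] at hv ⊢
  exact hL.comp hv fun x _ => ⟨hv0 x, hvM x⟩

theorem ofReal_infDist {E : Set X} (hE : E.Nonempty) (x : X) :
    infEDist x E = ENNReal.ofReal (infDist x E) :=
  (ENNReal.ofReal_toReal (infEDist_ne_top hE)).symm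

/-- A `(p, p - s)`-Hardy inequality implies a `(p + s, p)`-Hardy inequality, in a form where a small
multiple of the left-hand side is absorbed. -/
theorem HardyInequalityWith.lintegral_rpow_le [MeasurableSpace X] [BorelSpace X] {μ : Measure X}
    [IsFiniteMeasureOnCompacts μ] {Ω : Set X} {p s a : ℝ} {C : ℝ≥0} (hp : 1 ≤ p) (hs : 0 < s)
    (ha : 0 < a) (hC : C * (((p + s) / p) ^ p * (2 * a) ^ p) ≤ 1 / 2)
    (hH : HardyInequalityWith μ Ω p (p - s) C) (hΩ : IsOpen Ω) (hne : Ωᶜ.Nonempty)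
    {v h : X → ℝ} {K : ℝ≥0} {c M : ℝ} (hv : LipschitzWith K v) (hv0 : ∀ x, 0 ≤ v x)
    (hvM : ∀ x, v x ≤ M) (hvs : HasCompactSupport v) (hc : 0 < c)
    (hvc : ∀ x, infDist x Ωᶜ < c → v x = 0) (hh : Measurable h) (hh0 : ∀ x, 0 ≤ h x)
    (hb : CurveBound v fun x => a * v x / infDist x Ωᶜ + h x) :
    ∫⁻ x in Ω, ENNReal.ofReal (v x ^ (p + s) * infDist x Ωᶜ ^ (-s)) ∂μ ≤
      ENNReal.ofReal (2 * (C * (((p + s) / p) ^ p * (2 ^ p * a ^ (-s))))) *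
        ∫⁻ x in Ω, ENNReal.ofReal (h x ^ (p + s) * infDist x Ωᶜ ^ p) ∂μ := by
  set d : X → ℝ := fun x => infDist x Ωᶜ with hd
  set q : ℝ := (p + s) / p with hq
  have hp0 : 0 < p := by linarith
  have hq1 : 1 ≤ q := by rw [hq, le_div_iff₀ hp0]; linarith
  have hqp : q * p = p + s := by rw [hq]; field_simp
  have hdpos : ∀ x ∈ Ω, 0 < d x := fun x hx =>
    (hΩ.isClosed_compl.notMem_iff_infDist_pos hne).1 (by simpa using hx)
  have hdm : Measurable d := measurable_infDist
  have hvm : Measurable v := hv.continuous.measurable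
  obtain ⟨L, hL⟩ := hv.exists_rpow_const hv0 hvM hq1
  have hzero : (0 : ℝ) ^ q = 0 := Real.zero_rpow (by linarith)
  have hlip : IsLipZero Ω fun x => v x ^ q := by
    refine ⟨⟨L, hL⟩, hvs.comp_left (g := fun y => y ^ q) hzero, ?_⟩
    have h1 : tsupport (fun x => v x ^ q) ⊆ {x | c ≤ d x} := by
      refine closure_minimal (fun x hx => ?_)
        (isClosed_le continuous_const (continuous_infDist_pt _))
      by_contra hlt
      exact hx (by simp only [hvc x (not_le.1 hlt), hzero])
    refine h1.trans fun x hx => ?_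
    by_contra hxΩ
    have : d x = 0 := infDist_zero_of_mem hxΩ
    rw [mem_ofPred_eq, this] at hx
    linarith
  have hug : IsUpperGradient (fun x => v x ^ q)
      fun x => ENNReal.ofReal (q * v x ^ (q - 1) * (a * v x / d x + h x)) := by
    have h1 := hb.comp hv (f := fun y => y ^ q) (f' := fun y => q * y ^ (q - 1))
      fun x => Real.hasDerivAt_rpow_const (Or.inr hq1)
    have h2 : CurveBound (fun x => v x ^ q)
        fun x => q * v x ^ (q - 1) * (a * v x / d x + h x) := by
      refine h1.mono fun x => ?_
      have hvx := hv0 x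
      rw [abs_of_nonneg (by positivity)]
    exact h2.isUpperGradient hL (by fun_prop)
  have key := hH _ _ hlip hug
  have hleft : ∀ x ∈ Ω, ENNReal.ofReal |v x ^ q| ^ p * infEDist x Ωᶜ ^ (p - s - p) =
      ENNReal.ofReal (v x ^ (p + s) * d x ^ (-s)) := by
    intro x hx
    have hvx := hv0 x
    rw [abs_of_nonneg (by positivity), ENNReal.ofReal_rpow_of_nonneg (by positivity) hp0.le,
      ← Real.rpow_mul hvx, hqp, ofReal_infDist hne, ENNReal.ofReal_rpow_of_pos (hdpos x hx),
      ← ENNReal.ofReal_mul (by positivity)]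
    congr 3
    ring
  have hright : ∀ x ∈ Ω, C * (ENNReal.ofReal (q * v x ^ (q - 1) * (a * v x / d x + h x)) ^ p *
      infEDist x Ωᶜ ^ (p - s)) ≤
      ENNReal.ofReal (1 / 2) * ENNReal.ofReal (v x ^ (p + s) * d x ^ (-s)) +
      ENNReal.ofReal (C * (q ^ p * (2 ^ p * a ^ (-s)))) *
        ENNReal.ofReal (h x ^ (p + s) * d x ^ p) := by
    intro x hx
    have hvx := hv0 x
    have hhx := hh0 x
    have hdx := hdpos x hx
    rw [ENNReal.ofReal_rpow_of_nonneg (by positivity) hp0.le, ofReal_infDist hne,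
      ENNReal.ofReal_rpow_of_pos hdx, ← ENNReal.ofReal_mul (by positivity),
      ← ENNReal.ofReal_coe_nnreal, ← ENNReal.ofReal_mul (by positivity),
      ← ENNReal.ofReal_mul (by positivity), ← ENNReal.ofReal_mul (by positivity),
      ← ENNReal.ofReal_add (by positivity) (by positivity)]
    refine ENNReal.ofReal_le_ofReal ?_
    -- The exponent `q = (p + s) / p` is chosen so that `(q - 1) * p = s`.
    have e1 : (q * v x ^ (q - 1) * (a * v x / d x + h x)) ^ p * d x ^ (p - s) =
        q ^ p * d x ^ (-s) * (v x ^ s * (a * v x + h x * d x) ^ p) := by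
      have e2 : a * v x + h x * d x = (a * v x / d x + h x) * d x := by field_simp
      have e3 : (q - 1) * p = s := by linarith
      rw [e2, Real.mul_rpow (by positivity) (by positivity),
        Real.mul_rpow (by positivity) (by positivity), ← Real.rpow_mul hvx, e3,
        Real.mul_rpow (by positivity) hdx.le, sub_eq_add_neg, Real.rpow_add hdx]
      ring
    have e4 := Real.rpow_mul_add_rpow_le hp0.le hs.le ha hvx (mul_nonneg hhx hdx.le)
    have e5 : (h x * d x) ^ (p + s) * d x ^ (-s) = h x ^ (p + s) * d x ^ p := by
      rw [Real.mul_rpow hhx hdx.le, mul_assoc, ← Real.rpow_add hdx]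
      congr 2
      ring
    calc C * ((q * v x ^ (q - 1) * (a * v x / d x + h x)) ^ p * d x ^ (p - s))
        = C * (q ^ p * d x ^ (-s)) * (v x ^ s * (a * v x + h x * d x) ^ p) := by rw [e1]; ring
      _ ≤ C * (q ^ p * d x ^ (-s)) * ((2 * a) ^ p * v x ^ (p + s) +
          2 ^ p * a ^ (-s) * (h x * d x) ^ (p + s)) := by gcongr
      _ = C * (q ^ p * (2 * a) ^ p) * (v x ^ (p + s) * d x ^ (-s)) +
          C * (q ^ p * (2 ^ p * a ^ (-s))) * ((h x * d x) ^ (p + s) * d x ^ (-s)) := by ring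
      _ ≤ 1 / 2 * (v x ^ (p + s) * d x ^ (-s)) +
          C * (q ^ p * (2 ^ p * a ^ (-s))) * (h x ^ (p + s) * d x ^ p) := by
          rw [e5]
          gcongr
  rw [setLIntegral_congr_fun hΩ.measurableSet hleft,
    ← lintegral_const_mul' _ _ ENNReal.coe_ne_top] at key
  have key2 := key.trans (setLIntegral_mono' hΩ.measurableSet hright)
  rw [lintegral_add_left (by fun_prop), lintegral_const_mul' _ _ ENNReal.ofReal_ne_top,
    lintegral_const_mul' _ _ ENNReal.ofReal_ne_top] at key2
  -- Absorbing half of the left side requires it to be finite: `v` is bounded with compact support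
  -- and vanishes where the weight is singular.
  have hfin : ∫⁻ x in Ω, ENNReal.ofReal (v x ^ (p + s) * d x ^ (-s)) ∂μ ≠ ∞ := by
    refine ne_top_of_le_ne_top (b := ENNReal.ofReal (M ^ (p + s) * c ^ (-s)) * μ (tsupport v))
      (ENNReal.mul_ne_top ENNReal.ofReal_ne_top hvs.isCompact.measure_lt_top.ne) ?_
    calc ∫⁻ x in Ω, ENNReal.ofReal (v x ^ (p + s) * d x ^ (-s)) ∂μ
        ≤ ∫⁻ x, ENNReal.ofReal (v x ^ (p + s) * d x ^ (-s)) ∂μ := setLIntegral_le_lintegral _ _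
      _ ≤ ∫⁻ x, (tsupport v).indicator
          (fun _ => ENNReal.ofReal (M ^ (p + s) * c ^ (-s))) x ∂μ := by
          refine lintegral_mono fun x => ?_
          by_cases hx : v x = 0
          · simp only [hx]
            rw [Real.zero_rpow (by linarith)]
            simp
          · rw [indicator_of_mem (subset_tsupport v hx)]
            have hcd : c ≤ d x := by
              by_contra hlt
              exact hx (hvc x (not_le.1 hlt))
            have hvx := hv0 x
            have hM : 0 ≤ M := hvx.trans (hvM x)
            refine ENNReal.ofReal_le_ofReal (mul_le_mul
              (Real.rpow_le_rpow hvx (hvM x) (by linarith))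
              (Real.rpow_le_rpow_of_nonpos hc hcd (by linarith))
              (Real.rpow_nonneg (hc.le.trans hcd) _) (by positivity))
      _ = _ := by
          rw [lintegral_indicator_const (isClosed_tsupport v).measurableSet]
  have := ENNReal.le_two_mul_of_le_half_add hfin key2
  rwa [← mul_assoc, ← ENNReal.ofReal_ofNat 2, ← ENNReal.ofReal_mul zero_le_two] at this

end HardyPower

/-! ### Cutoffs and the bent power of the distance. -/

section TestFunction

variable {X : Type*} [MetricSpace X]

/-- The Lipschitz function of `dist y x` that is `0` for `dist y x ≤ k * r` and `1` for
`(k + 1) * r ≤ dist y x`. -/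
noncomputable def radialCutoff (x : X) (r k : ℝ) (y : X) : ℝ := max 0 (min 1 (dist y x / r - k))

theorem radialCutoff_nonneg (x : X) (r k : ℝ) (y : X) : 0 ≤ radialCutoff x r k y := le_max_left _ _

theorem radialCutoff_le_one (x : X) (r k : ℝ) (y : X) : radialCutoff x r k y ≤ 1 :=
  max_le zero_le_one (min_le_left _ _)

theorem radialCutoff_eq_zero {x y : X} {r k : ℝ} (hr : 0 < r) (h : dist y x ≤ k * r) :
    radialCutoff x r k y = 0 := by
  rw [← div_le_iff₀ hr] at h
  exact max_eq_left ((min_le_right _ _).trans (by linarith))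

theorem radialCutoff_eq_one {x y : X} {r k : ℝ} (hr : 0 < r) (h : (k + 1) * r ≤ dist y x) :
    radialCutoff x r k y = 1 := by
  rw [← le_div_iff₀ hr] at h
  rw [radialCutoff, min_eq_left (by linarith), max_eq_right zero_le_one]

theorem lipschitzWith_radialCutoff (x : X) {r : ℝ} (hr : 0 < r) (k : ℝ) :
    LipschitzWith (r⁻¹).toNNReal (radialCutoff x r k) := by
  refine LipschitzWith.const_max (LipschitzWith.const_min
    (LipschitzWith.of_dist_le_mul fun y z => ?_) 1) 0
  rw [Real.coe_toNNReal _ (by positivity), Real.dist_eq, sub_sub_sub_cancel_right, ← sub_div,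
    abs_div, abs_of_pos hr, div_eq_inv_mul]
  gcongr
  exact abs_dist_sub_le y z x

theorem curveBound_radialCutoff (x : X) {r : ℝ} (hr : 0 < r) (k : ℝ) :
    CurveBound (radialCutoff x r k) ((closedBall x ((k + 1) * r)).indicator fun _ => r⁻¹) := by
  have h := (lipschitzWith_radialCutoff x hr k).curveBound.indicator_compl
    (O := (closedBall x ((k + 1) * r))ᶜ) isClosed_closedBall.isOpen_compl (c := 1)
    fun y hy => radialCutoff_eq_one hr (by simpa using (le_of_lt (by simpa using hy)))
  rwa [compl_compl, Real.coe_toNNReal _ (by positivity)] at h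

theorem CurveBound.const_sub {u g : X → ℝ} (h : CurveBound u g) (c : ℝ) :
    CurveBound (fun x => c - u x) g := by
  intro l γ hγ
  filter_upwards [h l γ hγ] with t h ht
  have heq : (fun x => c - u x) ∘ γ = fun s => c - (u ∘ γ) s := rfl
  rw [heq, deriv_const_sub, abs_neg]
  exact h ht

/-- A function that vanishes on the balls `ball b.1 (2 * b.2)`, `b ∈ T`, equals `1` off the balls
`closedBall b.1 (3 * b.2)` and has a curve bound controlled by the radii. -/
theorem exists_cutoff [MeasurableSpace X] [BorelSpace X] (T : Finset (X × ℝ))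
    (hT : ∀ b ∈ T, 0 < b.2) {P : ℝ} (hP : 0 < P) :
    ∃ (φ G : X → ℝ) (K : ℝ≥0), LipschitzWith K φ ∧ (∀ y, 0 ≤ φ y) ∧ (∀ y, φ y ≤ 1) ∧
      (∀ b ∈ T, ∀ y ∈ ball b.1 (2 * b.2), φ y = 0) ∧
      (∀ y, (∀ b ∈ T, y ∉ closedBall b.1 (3 * b.2)) → φ y = 1) ∧
      CurveBound φ G ∧ Measurable G ∧ (∀ y, 0 ≤ G y) ∧
      ∀ y, G y ^ P ≤ ∑ b ∈ T, (closedBall b.1 (3 * b.2)).indicator (fun _ => b.2 ^ (-P)) y := by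
  classical
  induction T using Finset.induction_on with
  | empty =>
    refine ⟨fun _ => 1, fun _ => 0, 0, LipschitzWith.const _, fun _ => zero_le_one,
      fun _ => le_rfl, by simp, fun _ _ => rfl, (LipschitzWith.const (1 : ℝ)).curveBound,
      measurable_const, fun _ => le_rfl, fun y => by simp [Real.zero_rpow hP.ne']⟩
  | insert b T hbT ih =>
    obtain ⟨φ, G, K, hK, h0, h1, hz, ho, hb, hm, hG0, hG⟩ :=
      ih fun b hb => hT b (Finset.mem_insert_of_mem hb)
    have hbr : 0 < b.2 := hT b (Finset.mem_insert_self _ _)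
    have hL := lipschitzWith_radialCutoff b.1 hbr 2
    have hB := curveBound_radialCutoff b.1 hbr 2
    norm_num at hB
    have hbP : (0 : ℝ) < b.2 ^ (-P) := Real.rpow_pos_of_pos hbr _
    have hsum : ∀ y, 0 ≤ ∑ b ∈ T,
        (closedBall b.1 (3 * b.2)).indicator (fun _ => b.2 ^ (-P)) y := fun y =>
      (Real.rpow_nonneg (hG0 y) P).trans (hG y)
    refine ⟨fun y => min (radialCutoff b.1 b.2 2 y) (φ y), _, _, hL.min hK,
      fun y => le_min (radialCutoff_nonneg _ _ _ _) (h0 y), fun y => (min_le_right _ _).trans (h1 y),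
      fun b' hb' y hy => ?_, fun y hy => ?_, hB.min hb hL hK, ?_, fun y => ?_, fun y => ?_⟩
    · dsimp only
      rcases Finset.mem_insert.1 hb' with rfl | hb'
      · rw [radialCutoff_eq_zero hbr (mem_ball.1 hy).le, min_eq_left (h0 y)]
      · rw [hz b' hb' y hy, min_eq_right (radialCutoff_nonneg _ _ _ _)]
    · dsimp only
      rw [ho y fun b' hb' => hy b' (Finset.mem_insert_of_mem hb'), radialCutoff_eq_one hbr,
        min_self]
      have := hy b (Finset.mem_insert_self _ _)
      rw [mem_closedBall, not_le] at this
      linarith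
    · exact Measurable.ite (measurableSet_le hL.continuous.measurable hK.continuous.measurable)
        (measurable_const.indicator measurableSet_closedBall) hm
    · split_ifs
      · exact indicator_nonneg (fun _ _ => (inv_pos.2 hbr).le) y
      · exact hG0 y
    · rw [Finset.sum_insert hbT]
      split_ifs
      · refine le_add_of_le_of_nonneg ?_ (hsum y)
        by_cases hy : y ∈ closedBall b.1 (3 * b.2)
        · rw [indicator_of_mem hy, indicator_of_mem hy, Real.inv_rpow hbr.le,
            Real.rpow_neg hbr.le]
        · rw [indicator_of_notMem hy, indicator_of_notMem hy, Real.zero_rpow hP.ne']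
      · exact le_add_of_nonneg_of_le (indicator_nonneg (fun _ _ => hbP.le) y) (hG y)

theorem LipschitzWith.mul_of_abs_le {f g : X → ℝ} {K L : ℝ≥0} (hf : LipschitzWith K f)
    (hg : LipschitzWith L g) {M N : ℝ≥0} (hM : ∀ x, |f x| ≤ M) (hN : ∀ x, |g x| ≤ N) :
    LipschitzWith (M * L + N * K) fun x => f x * g x := by
  refine LipschitzWith.of_dist_le_mul fun x y => ?_
  have h1 := hf.dist_le_mul x y
  have h2 := hg.dist_le_mul x y
  rw [Real.dist_eq] at h1 h2 ⊢
  have : f x * g x - f y * g y = f x * (g x - g y) + g y * (f x - f y) := by ring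
  rw [this]
  push_cast
  calc |f x * (g x - g y) + g y * (f x - f y)| ≤ |f x| * |g x - g y| + |g y| * |f x - f y| := by
        rw [← abs_mul, ← abs_mul]
        exact abs_add_le _ _
    _ ≤ M * (L * dist x y) + N * (K * dist x y) := by
        gcongr
        · exact hM x
        · exact hN y
    _ = _ := by ring

/-- The weight `min (t ^ (-2a) τ ^ a) (τ ^ (-a))`, which equals `τ ^ (-a)` for `τ ≥ t` and tends
to zero as `τ → 0`. -/
noncomputable def peakWeight (a t τ : ℝ) : ℝ := min (t ^ (-(2 * a)) * τ ^ a) (τ ^ (-a))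

theorem peakWeight_nonneg {a t τ : ℝ} (ht : 0 ≤ t) (hτ : 0 ≤ τ) : 0 ≤ peakWeight a t τ :=
  le_min (by positivity) (by positivity)

theorem peakWeight_of_le {a t τ : ℝ} (ha : 0 ≤ a) (ht : 0 < t) (hτ : t ≤ τ) :
    peakWeight a t τ = τ ^ (-a) := by
  have hτ0 : 0 < τ := ht.trans_le hτ
  refine min_eq_right ?_
  calc τ ^ (-a) = τ ^ (-(2 * a)) * τ ^ a := by
        rw [← Real.rpow_add hτ0]
        ring_nf
    _ ≤ t ^ (-(2 * a)) * τ ^ a := by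
        have := Real.rpow_le_rpow_of_nonpos ht hτ (show -(2 * a) ≤ 0 by linarith)
        gcongr

theorem measurable_peakWeight (a t : ℝ) : Measurable (peakWeight a t) := by
  unfold peakWeight
  fun_prop

theorem LipschitzWith.exists_rpow_const_of_pos {u : X → ℝ} {K : ℝ≥0} (hu : LipschitzWith K u)
    {c D : ℝ} (hc : 0 < c) (huI : ∀ x, u x ∈ Icc c D) (q : ℝ) :
    ∃ L : ℝ≥0, LipschitzWith L fun x => u x ^ q := by
  obtain ⟨L, hL⟩ := ContDiffOn.exists_lipschitzOnWith (s := Icc c D) (n := 1)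
    (f := fun y : ℝ => y ^ q)
    (fun y hy => (Real.contDiffAt_rpow_const_of_ne (hc.trans_le hy.1).ne').contDiffWithinAt)
    one_ne_zero (convex_Icc c D) isCompact_Icc
  refine ⟨L * K, ?_⟩
  rw [← lipschitzOnWith_univ] at hu ⊢
  exact hL.comp hu fun x _ => huI x

/-- Both branches `τ ^ a` and `τ ^ (-a)` have logarithmic derivative `± a / τ`, so bending the power
does not spoil the gradient bound. -/
theorem exists_lipschitzWith_peakWeight {u : X → ℝ} {K : ℝ≥0} (hu : LipschitzWith K u)
    {c D : ℝ} (hc : 0 < c) (huI : ∀ x, u x ∈ Icc c D) (hb : CurveBound u fun _ => 1) {a t : ℝ}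
    (ha : 0 < a) (ht : 0 < t) :
    (∃ L : ℝ≥0, LipschitzWith L fun x => peakWeight a t (u x)) ∧
      CurveBound (fun x => peakWeight a t (u x)) fun x => a * peakWeight a t (u x) / u x := by
  obtain ⟨L₁, hL₁⟩ := hu.exists_rpow_const_of_pos hc huI a
  obtain ⟨L₂, hL₂⟩ := hu.exists_rpow_const_of_pos hc huI (-a)
  have hu0 : ∀ x, 0 < u x := fun x => hc.trans_le (huI x).1
  have hL₁' : LipschitzWith ((t ^ (-(2 * a))).toNNReal * L₁)
      fun x => t ^ (-(2 * a)) * u x ^ a := by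
    refine LipschitzWith.of_dist_le_mul fun x y => ?_
    have htp : 0 < t ^ (-(2 * a)) := by positivity
    have h1 := hL₁.dist_le_mul x y
    rw [Real.dist_eq] at h1 ⊢
    rw [← mul_sub, abs_mul, abs_of_pos htp, NNReal.coe_mul, Real.coe_toNNReal _ htp.le, mul_assoc]
    gcongr
  have hb₁ := hb.comp hu (f := fun τ => t ^ (-(2 * a)) * τ ^ a)
    (f' := fun τ => t ^ (-(2 * a)) * (a * τ ^ (a - 1)))
    fun x => (Real.hasDerivAt_rpow_const (Or.inl (hu0 x).ne')).const_mul _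
  have hb₂ := hb.comp hu (f := fun τ => τ ^ (-a)) (f' := fun τ => -a * τ ^ (-a - 1))
    fun x => Real.hasDerivAt_rpow_const (Or.inl (hu0 x).ne')
  refine ⟨⟨_, hL₁'.min hL₂⟩, (hb₁.min hb₂ hL₁' hL₂).mono fun x => ?_⟩
  have hx := hu0 x
  split_ifs with h
  · rw [peakWeight, min_eq_left h, mul_one, abs_of_nonneg (by positivity), Real.rpow_sub_one hx.ne']
    apply le_of_eq
    ring
  · rw [peakWeight, min_eq_right (le_of_not_ge h), mul_one, abs_mul, abs_neg, abs_of_pos ha,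
      abs_of_nonneg (by positivity), Real.rpow_sub_one hx.ne']
    apply le_of_eq
    ring

end TestFunction

/-! ### The test function. -/

section TestFunction

variable {X : Type*} [MetricSpace X]

theorem exists_testFunction [MeasurableSpace X] [BorelSpace X] [ProperSpace X] {E : Set X}
    (hE : IsClosed E) {x : X} (hx : x ∈ E) {R t a P : ℝ} (hR : 0 < R) (ht : 0 < t) (ha : 0 < a)
    (hP : 0 < P) {T : Finset (X × ℝ)} (hT : ∀ b ∈ T, 0 < b.2)
    (hcov : E ∩ closedBall x (2 * R) ⊆ ⋃ b ∈ T, ball b.1 (2 * b.2)) :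
    ∃ (v G : X → ℝ) (K : ℝ≥0) (c M : ℝ), LipschitzWith K v ∧ (∀ y, 0 ≤ v y) ∧ (∀ y, v y ≤ M) ∧
      HasCompactSupport v ∧ 0 < c ∧ (∀ y, infDist y E < c → v y = 0) ∧ Measurable G ∧
      (∀ y, 0 ≤ G y) ∧
      (∀ y, G y ^ P ≤ ∑ b ∈ T, (closedBall b.1 (3 * b.2)).indicator (fun _ => b.2 ^ (-P)) y) ∧
      CurveBound v (fun y => a * v y / infDist y E +
        peakWeight a t (infDist y E) * (G y + (closedBall x (2 * R)).indicator (fun _ => R⁻¹) y)) ∧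
      ∀ y ∈ closedBall x R, t ≤ infDist y E → (∀ b ∈ T, y ∉ closedBall b.1 (3 * b.2)) →
        v y = infDist y E ^ (-a) := by
  set d : X → ℝ := fun y => infDist y E with hd
  obtain ⟨φ, G, K, hK, h0, h1, hz, ho, hb, hm, hG0, hG⟩ := exists_cutoff T hT hP
  have hne : E.Nonempty := ⟨x, hx⟩
  -- the support avoids a neighbourhood of `E`
  have hcomp : IsCompact (closedBall x (2 * R) \ ⋃ b ∈ T, ball b.1 (2 * b.2)) :=
    (isCompact_closedBall x (2 * R)).diff (isOpen_biUnion fun _ _ => isOpen_ball)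
  obtain ⟨c₀, hc₀, hlt⟩ := Metric.exists_pos_forall_lt_edist hcomp hE <| by
    refine disjoint_left.2 fun y hy hyE => hy.2 (hcov ⟨hyE, hy.1⟩)
  -- The minimum with `2 * R` keeps the truncation interval `[c, 2 * R]` nonempty.
  set c : ℝ := min c₀ (2 * R) with hcdef
  have hc : 0 < c := lt_min hc₀ (by positivity)
  have hcd : ∀ y ∈ closedBall x (2 * R) \ ⋃ b ∈ T, ball b.1 (2 * b.2), c ≤ d y := by
    intro y hy
    refine (min_le_left _ _).trans ((le_infDist hne).2 fun z hz => ?_)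
    have := hlt y hy z hz
    rw [edist_nndist] at this
    have h2 : c₀ < nndist y z := by exact_mod_cast this
    rw [← coe_nndist]
    exact_mod_cast h2.le
  have hdR : ∀ y ∈ closedBall x (2 * R), d y ≤ 2 * R := fun y hy =>
    (infDist_le_dist_of_mem hx).trans (mem_closedBall.1 hy)
  set ψ : X → ℝ := fun y => 1 - radialCutoff x R 1 y with hψ
  have hψb : CurveBound ψ ((closedBall x (2 * R)).indicator fun _ => R⁻¹) := by
    have := (curveBound_radialCutoff x hR 1).const_sub 1
    rwa [one_add_one_eq_two] at this
  have hψL : LipschitzWith (R⁻¹).toNNReal ψ := by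
    refine LipschitzWith.of_dist_le_mul fun y z => ?_
    rw [hψ, dist_sub_left]
    exact (lipschitzWith_radialCutoff x hR 1).dist_le_mul y z
  have hψ0 : ∀ y, 0 ≤ ψ y := fun y => sub_nonneg.2 (radialCutoff_le_one _ _ _ _)
  have hψ1 : ∀ y, ψ y ≤ 1 := fun y => by
    have := radialCutoff_nonneg x R 1 y
    simp only [hψ]
    linarith
  have hψz : ∀ y, y ∉ closedBall x (2 * R) → ψ y = 0 := fun y hy => by
    rw [mem_closedBall, not_le] at hy
    simp only [hψ]
    rw [radialCutoff_eq_one hR (by linarith), sub_self]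
  have hψo : ∀ y ∈ closedBall x R, ψ y = 1 := fun y hy => by
    rw [mem_closedBall] at hy
    simp only [hψ]
    rw [radialCutoff_eq_zero hR (by linarith), sub_zero]
  -- the truncated distance
  set u : X → ℝ := fun y => max c (min (2 * R) (d y)) with hu
  have huL : LipschitzWith 1 u := ((lipschitz_infDist_pt E).const_min _).const_max _
  have huI : ∀ y, u y ∈ Icc c (2 * R) := fun y =>
    ⟨le_max_left _ _, max_le (min_le_right _ _) (min_le_left _ _)⟩
  have hub : CurveBound u fun _ => 1 := by simpa using huL.curveBound
  have hueq : ∀ y, c ≤ d y → y ∈ closedBall x (2 * R) → u y = d y := fun y h1 h2 => by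
    simp only [hu]
    rw [min_eq_right (hdR y h2), max_eq_right h1]
  obtain ⟨⟨L, hL⟩, hwb⟩ := exists_lipschitzWith_peakWeight huL hc huI hub ha ht
  have hw0 : ∀ y, 0 ≤ peakWeight a t (u y) := fun y =>
    peakWeight_nonneg ht.le (hc.le.trans (huI y).1)
  obtain ⟨M, hM⟩ : ∃ M : ℝ≥0, ∀ y, |peakWeight a t (u y)| ≤ M := by
    refine ⟨(t ^ (-(2 * a)) * (2 * R) ^ a).toNNReal, fun y => ?_⟩
    rw [abs_of_nonneg (hw0 y), Real.coe_toNNReal _ (by positivity)]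
    refine (min_le_left _ _).trans ?_
    have := huI y
    have : 0 ≤ u y := hc.le.trans (huI y).1
    gcongr
    exact (huI y).2
  have hφ1 : ∀ y, |φ y| ≤ (1 : ℝ≥0) := fun y => by simpa [abs_of_nonneg (h0 y)] using h1 y
  have hψ1' : ∀ y, |ψ y| ≤ (1 : ℝ≥0) := fun y => by simpa [abs_of_nonneg (hψ0 y)] using hψ1 y
  have hφψ := hK.mul_of_abs_le hψL hφ1 hψ1'
  have hφψ0 : ∀ y, 0 ≤ φ y * ψ y := fun y => mul_nonneg (h0 y) (hψ0 y)
  have hφψ1 : ∀ y, φ y * ψ y ≤ 1 := fun y => mul_le_one₀ (h1 y) (hψ0 y) (hψ1 y)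
  have hvL := hφψ.mul_of_abs_le hL (M := 1) (N := M)
    (fun y => by simpa [abs_of_nonneg (h0 y), abs_of_nonneg (hψ0 y)] using hφψ1 y) hM
  have hvz : ∀ y, (y ∉ closedBall x (2 * R) ∨ d y < c) → φ y * ψ y * peakWeight a t (u y) = 0 := by
    intro y hy
    by_cases hyB : y ∈ closedBall x (2 * R)
    · have hyd := hy.resolve_left (not_not.2 hyB)
      by_cases hyT : y ∈ ⋃ b ∈ T, ball b.1 (2 * b.2)
      · simp only [mem_iUnion] at hyT
        obtain ⟨b, hbT, hyb⟩ := hyT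
        rw [hz b hbT y hyb, zero_mul, zero_mul]
      · exact absurd (hcd y ⟨hyB, hyT⟩) (not_le.2 hyd)
    · rw [hψz y hyB, mul_zero, zero_mul]
  refine ⟨fun y => φ y * ψ y * peakWeight a t (u y), G, _, c, M, hvL,
    fun y => mul_nonneg (hφψ0 y) (hw0 y), fun y => ?_, ?_, hc, fun y hy => hvz y (Or.inr hy),
    hm, hG0, hG, ?_, fun y hy hty hyT => ?_⟩
  · exact (mul_le_of_le_one_left (hw0 y) (hφψ1 y)).trans ((le_abs_self _).trans (hM y))
  · exact HasCompactSupport.intro (isCompact_closedBall x (2 * R)) fun y hy => hvz y (Or.inl hy)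
  · have h1' := (hb.mul hψb hK hψL).mul hwb hφψ hL
    -- On this open set the product vanishes, so its gradient may be taken to be zero there; on the
    -- complement the truncated distance equals `d`.
    refine (h1'.indicator_compl (O := (closedBall x (2 * R))ᶜ ∪ {y | d y < c})
      (isClosed_closedBall.isOpen_compl.union
        (isOpen_lt (continuous_infDist_pt E) continuous_const)) (c := 0) hvz).mono fun y => ?_
    have hφy := h0 y
    have hψy := hψ0 y
    have hGy := hG0 y
    have hdy : 0 ≤ d y := infDist_nonneg
    have hwy := hw0 y
    have hwd : 0 ≤ peakWeight a t (d y) := peakWeight_nonneg ht.le hdy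
    have hi : 0 ≤ (closedBall x (2 * R)).indicator (fun _ => R⁻¹) y :=
      indicator_nonneg (fun _ _ => (inv_pos.2 hR).le) y
    change _ ≤ a * (φ y * ψ y * peakWeight a t (u y)) / d y + peakWeight a t (d y) *
      (G y + (closedBall x (2 * R)).indicator (fun _ => R⁻¹) y)
    by_cases hy : y ∈ ((closedBall x (2 * R))ᶜ ∪ {y | d y < c})ᶜ
    · rw [indicator_of_mem hy]
      simp only [mem_compl_iff, mem_union, not_or, not_not, mem_ofPred_eq, not_lt] at hy
      rw [hueq y hy.2 hy.1, abs_of_nonneg (mul_nonneg hφy hψy), abs_of_nonneg hφy,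
        abs_of_nonneg hψy, abs_of_nonneg hwd]
      refine add_le_add (le_of_eq (by ring)) (mul_le_mul_of_nonneg_left ?_ hwd)
      rw [add_comm]
      exact add_le_add (mul_le_of_le_one_left hGy (hψ1 y)) (mul_le_of_le_one_left hi (h1 y))
    · rw [indicator_of_notMem hy]
      positivity
  · have hyB : y ∈ closedBall x (2 * R) := closedBall_subset_closedBall (by linarith) hy
    have hyT' : y ∉ ⋃ b ∈ T, ball b.1 (2 * b.2) := by
      simp only [mem_iUnion, not_exists]
      intro b hbT hyb
      have := hT b hbT
      exact hyT b hbT (ball_subset_closedBall (ball_subset_ball (by linarith) hyb))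
    have := hueq y (hcd y ⟨hyB, hyT'⟩) hyB
    simp only [this]
    rw [ho y hyT, hψo y hy, one_mul, one_mul, peakWeight_of_le ha.le ht hty]

end TestFunction

/-! ### The measure of a layer, in terms of a finite cover of the complement. -/

section Layer

/-- The first bound, with its gain of `τ ^ (a * P)`, serves on the covering balls; the second, free
of `t`, serves for the outer cutoff. -/
theorem peakWeight_rpow_mul_le {a t τ P p : ℝ} (ht : 0 < t) (hτ : 0 < τ) (hP : 0 ≤ P) :
    peakWeight a t τ ^ P * τ ^ p ≤ t ^ (-(2 * (a * P))) * τ ^ (p + a * P) ∧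
      peakWeight a t τ ^ P * τ ^ p ≤ τ ^ (p - a * P) := by
  have h0 := peakWeight_nonneg (a := a) ht.le hτ.le
  constructor
  · calc peakWeight a t τ ^ P * τ ^ p ≤ (t ^ (-(2 * a)) * τ ^ a) ^ P * τ ^ p := by
          gcongr
          exact min_le_left _ _
      _ = t ^ (-(2 * (a * P))) * τ ^ (p + a * P) := by
          rw [Real.mul_rpow (by positivity) (by positivity), ← Real.rpow_mul ht.le,
            ← Real.rpow_mul hτ.le, Real.rpow_add hτ]
          ring_nf
  · calc peakWeight a t τ ^ P * τ ^ p ≤ (τ ^ (-a)) ^ P * τ ^ p := by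
          gcongr
          exact min_le_right _ _
      _ = τ ^ (p - a * P) := by
          rw [← Real.rpow_mul hτ.le, ← Real.rpow_add hτ]
          ring_nf

theorem ENNReal.ofReal_indicator_const {α : Type*} (s : Set α) (c : ℝ) (y : α) :
    ENNReal.ofReal (s.indicator (fun _ => c) y) = s.indicator (fun _ => ENNReal.ofReal c) y := by
  by_cases hy : y ∈ s <;> simp [hy]

variable {X : Type*} [MetricSpace X] [MeasurableSpace X] [BorelSpace X] [ProperSpace X]
  {μ : Measure X} [IsFiniteMeasureOnCompacts μ] {Ω : Set X} {p s a : ℝ} {C : ℝ≥0}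

theorem HardyInequalityWith.measure_layer_le_of_cover (hp : 1 ≤ p) (hs : 0 < s)
    (ha : 0 < a) (hC : C * (((p + s) / p) ^ p * (2 * a) ^ p) ≤ 1 / 2)
    (had : a * (p + s) ≤ p)
    (hH : HardyInequalityWith μ Ω p (p - s) C) (hΩ : IsOpen Ω) {x : X} (hx : x ∈ Ωᶜ)
    {R r t : ℝ} (hR : 0 < R) (ht : 0 < t) {T : Finset (X × ℝ)} (hT : ∀ b ∈ T, 0 < b.2)
    (hcov : Ωᶜ ∩ closedBall x (2 * R) ⊆ ⋃ b ∈ T, ball b.1 (2 * b.2))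
    (hmeet : ∀ b ∈ T, (closedBall b.1 b.2 ∩ Ωᶜ).Nonempty) :
    ENNReal.ofReal (r ^ (-(s + a * (p + s)))) *
      μ (({y | t ≤ infDist y Ωᶜ ∧ infDist y Ωᶜ < r} ∩ closedBall x R) \
        ⋃ b ∈ T, closedBall b.1 (3 * b.2)) ≤
    ENNReal.ofReal (2 * (C * (((p + s) / p) ^ p * (2 ^ p * a ^ (-s))))) *
      ((∑ b ∈ T, ENNReal.ofReal (2 ^ (p + s) * (t ^ (-(2 * (a * (p + s)))) *
          4 ^ (p + a * (p + s))) * b.2 ^ (-(s - a * (p + s)))) * μ (closedBall b.1 (3 * b.2))) +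
        ENNReal.ofReal (2 ^ (p + s) * 2 ^ (p - a * (p + s)) * R ^ (-(s + a * (p + s)))) *
          μ (closedBall x (2 * R))) := by
  set P : ℝ := p + s with hPdef
  have hP : 0 < P := by positivity
  set δ : ℝ := a * P with hδ
  have hδ0 : 0 < δ := by positivity
  set d : X → ℝ := fun y => infDist y Ωᶜ with hd
  have hne : Ωᶜ.Nonempty := ⟨x, hx⟩
  have hdm : Measurable d := measurable_infDist
  have hdpos : ∀ y ∈ Ω, 0 < d y := fun y hy =>
    (hΩ.isClosed_compl.notMem_iff_infDist_pos hne).1 (by simpa using hy)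
  obtain ⟨v, G, K, c, M, hv, hv0, hvM, hvs, hc, hvc, hGm, hG0, hG, hb, hveq⟩ :=
    exists_testFunction hΩ.isClosed_compl hx hR ht ha hP hT hcov
  set i : X → ℝ := (closedBall x (2 * R)).indicator fun _ => R⁻¹ with hi
  have hi0 : ∀ y, 0 ≤ i y := fun y => indicator_nonneg (fun _ _ => (inv_pos.2 hR).le) y
  have him : Measurable i := measurable_const.indicator measurableSet_closedBall
  have key := hH.lintegral_rpow_le hp hs ha hC hΩ hne hv hv0 hvM hvs hc hvc
    (h := fun y => peakWeight a t (d y) * (G y + i y))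
    (((measurable_peakWeight a t).comp hdm).mul (hGm.add him))
    (fun y => mul_nonneg (peakWeight_nonneg ht.le infDist_nonneg) (add_nonneg (hG0 y) (hi0 y))) hb
  refine le_trans ?_ (key.trans (mul_le_mul_right ?_ _))
  · set A := ({y | t ≤ d y ∧ d y < r} ∩ closedBall x R) \ ⋃ b ∈ T, closedBall b.1 (3 * b.2)
      with hA
    have hAm : MeasurableSet A := by
      refine ((MeasurableSet.inter ?_ measurableSet_closedBall)).diff
        (Finset.measurableSet_biUnion _ fun _ _ => measurableSet_closedBall)
      exact (measurableSet_le measurable_const hdm).inter (measurableSet_lt hdm measurable_const)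
    have hAΩ : A ⊆ Ω := by
      intro y hy
      by_contra hyΩ
      have h0 : d y = 0 := infDist_zero_of_mem hyΩ
      have h1 : t ≤ d y := hy.1.1.1
      linarith
    calc ENNReal.ofReal (r ^ (-(s + δ))) * μ A
        = ∫⁻ _ in A, ENNReal.ofReal (r ^ (-(s + δ))) ∂μ := by rw [setLIntegral_const]
      _ ≤ ∫⁻ y in A, ENNReal.ofReal (v y ^ P * d y ^ (-s)) ∂μ := by
          refine setLIntegral_mono' hAm fun y hy => ENNReal.ofReal_le_ofReal ?_
          have h1 : t ≤ d y := hy.1.1.1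
          have h2 : d y < r := hy.1.1.2
          have hdy : 0 < d y := ht.trans_le h1
          have h3 := hveq y hy.1.2 h1 fun b hbT hyb => hy.2 (mem_iUnion₂.2 ⟨b, hbT, hyb⟩)
          rw [h3, ← Real.rpow_mul hdy.le, ← Real.rpow_add hdy]
          have e : -a * P + -s = -(s + δ) := by rw [hδ]; ring
          rw [e]
          exact Real.rpow_le_rpow_of_nonpos hdy h2.le (by linarith)
      _ ≤ ∫⁻ y in Ω, ENNReal.ofReal (v y ^ P * d y ^ (-s)) ∂μ :=
          lintegral_mono_set hAΩ
  · have hpt : ∀ y ∈ Ω, ENNReal.ofReal ((peakWeight a t (d y) * (G y + i y)) ^ P * d y ^ p) ≤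
        (∑ b ∈ T, (closedBall b.1 (3 * b.2)).indicator (fun _ => ENNReal.ofReal
          (2 ^ P * (t ^ (-(2 * δ)) * 4 ^ (p + δ)) * b.2 ^ (-(s - δ)))) y) +
        (closedBall x (2 * R)).indicator
          (fun _ => ENNReal.ofReal (2 ^ P * 2 ^ (p - δ) * R ^ (-(s + δ)))) y := by
      intro y hy
      have hdy := hdpos y hy
      have hW := peakWeight_nonneg (a := a) ht.le hdy.le
      obtain ⟨hW1, hW2⟩ := peakWeight_rpow_mul_le (a := a) (p := p) ht hdy hP.le
      have hGi := Real.rpow_mul_add_rpow_le (a := 1) hP.le le_rfl one_pos (hG0 y) (hi0 y)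
      simp only [Real.rpow_zero, one_mul, mul_one, add_zero, neg_zero] at hGi
      have hiP : i y ^ P = (closedBall x (2 * R)).indicator (fun _ => R ^ (-P)) y := by
        by_cases hyB : y ∈ closedBall x (2 * R)
        · rw [hi, indicator_of_mem hyB, indicator_of_mem hyB, Real.inv_rpow hR.le,
            Real.rpow_neg hR.le]
        · rw [hi, indicator_of_notMem hyB, indicator_of_notMem hyB, Real.zero_rpow hP.ne']
      have hG' := hG0 y
      have hi' := hi0 y
      have hsum : ∀ b ∈ T, 0 ≤ (closedBall b.1 (3 * b.2)).indicator (fun _ =>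
          2 ^ P * (t ^ (-(2 * δ)) * 4 ^ (p + δ)) * b.2 ^ (-(s - δ))) y := fun b hbT => by
        have := hT b hbT
        exact indicator_nonneg (fun _ _ => by positivity) y
      simp only [← ENNReal.ofReal_indicator_const]
      rw [← ENNReal.ofReal_sum_of_nonneg hsum, ← ENNReal.ofReal_add (Finset.sum_nonneg hsum)
        (indicator_nonneg (fun _ _ => by positivity) y)]
      refine ENNReal.ofReal_le_ofReal ?_
      have hterm1 : peakWeight a t (d y) ^ P * d y ^ p * (2 ^ P * G y ^ P) ≤
          ∑ b ∈ T, (closedBall b.1 (3 * b.2)).indicator (fun _ =>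
          2 ^ P * (t ^ (-(2 * δ)) * 4 ^ (p + δ)) * b.2 ^ (-(s - δ))) y := by
        calc peakWeight a t (d y) ^ P * d y ^ p * (2 ^ P * G y ^ P)
            ≤ t ^ (-(2 * δ)) * d y ^ (p + δ) * (2 ^ P * ∑ b ∈ T,
              (closedBall b.1 (3 * b.2)).indicator (fun _ => b.2 ^ (-P)) y) := by
              gcongr
              exact hG y
          _ ≤ _ := by
              rw [Finset.mul_sum, Finset.mul_sum]
              refine Finset.sum_le_sum fun b hbT => ?_
              have hb2 := hT b hbT
              by_cases hyb : y ∈ closedBall b.1 (3 * b.2)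
              · rw [indicator_of_mem hyb, indicator_of_mem hyb]
                obtain ⟨z, hz, hzΩ⟩ := hmeet b hbT
                -- The ball of radius `b.2` meets `Ωᶜ`, and `y` lies within `3 * b.2` of its centre.
                have hd4 : d y ≤ 4 * b.2 := by
                  refine (infDist_le_dist_of_mem hzΩ).trans
                    ((dist_triangle_right y z b.1).trans ?_)
                  rw [mem_closedBall] at hz hyb
                  linarith
                -- This is where the content of codimension `s - δ` appears.
                have e : -(s - δ) = (p + δ) + -P := by rw [hPdef]; ring
                rw [e, Real.rpow_add hb2]
                calc t ^ (-(2 * δ)) * d y ^ (p + δ) * (2 ^ P * b.2 ^ (-P))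
                    ≤ t ^ (-(2 * δ)) * (4 * b.2) ^ (p + δ) * (2 ^ P * b.2 ^ (-P)) := by gcongr
                  _ = _ := by
                      rw [Real.mul_rpow (by norm_num) hb2.le]
                      ring
              · rw [indicator_of_notMem hyb, indicator_of_notMem hyb]
                simp
      have hterm2 : peakWeight a t (d y) ^ P * d y ^ p * (2 ^ P * i y ^ P) ≤
          (closedBall x (2 * R)).indicator
          (fun _ => 2 ^ P * 2 ^ (p - δ) * R ^ (-(s + δ))) y := by
        rw [hiP]
        by_cases hyB : y ∈ closedBall x (2 * R)
        · rw [indicator_of_mem hyB, indicator_of_mem hyB]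
          have hd2 : d y ≤ 2 * R := (infDist_le_dist_of_mem hx).trans (mem_closedBall.1 hyB)
          have e : -(s + δ) = (p - δ) + -P := by rw [hPdef]; ring
          rw [e, Real.rpow_add hR]
          calc peakWeight a t (d y) ^ P * d y ^ p * (2 ^ P * R ^ (-P))
              ≤ (2 * R) ^ (p - δ) * (2 ^ P * R ^ (-P)) := by
                gcongr
                exact hW2.trans (Real.rpow_le_rpow hdy.le hd2 (by linarith))
            _ = _ := by
                rw [Real.mul_rpow (by norm_num) hR.le]
                ring
        · rw [indicator_of_notMem hyB, indicator_of_notMem hyB]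
          simp
      refine le_trans ?_ (add_le_add hterm1 hterm2)
      rw [Real.mul_rpow hW (add_nonneg hG' hi')]
      calc peakWeight a t (d y) ^ P * (G y + i y) ^ P * d y ^ p
          ≤ peakWeight a t (d y) ^ P * (2 ^ P * G y ^ P + 2 ^ P * 1 ^ (0 : ℝ) * i y ^ P) *
            d y ^ p := by
            gcongr
            simpa using hGi
        _ = _ := by
            rw [Real.one_rpow]
            ring
    refine (setLIntegral_mono' hΩ.measurableSet hpt).trans ((setLIntegral_le_lintegral _ _).trans ?_)
    rw [lintegral_add_right _ (measurable_const.indicator measurableSet_closedBall),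
      lintegral_finsetSum _ fun b _ => measurable_const.indicator measurableSet_closedBall,
      lintegral_indicator_const measurableSet_closedBall]
    simp only [lintegral_indicator_const measurableSet_closedBall]
    exact le_rfl

end Layer

/-! ### From vanishing content to the Assouad codimension. -/

section Codimension

theorem ENNReal.le_of_forall_le_add_mul {x y Z : ℝ≥0∞} (hZ : Z ≠ ∞)
    (h : ∀ τ : ℝ≥0∞, 0 < τ → x ≤ y + Z * τ) : x ≤ y := by
  have h1 : Tendsto (fun τ : ℝ≥0∞ => y + Z * τ) (𝓝[>] 0) (𝓝 (y + Z * 0)) :=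
    (tendsto_const_nhds.add (ENNReal.Tendsto.const_mul tendsto_id (Or.inr hZ))).mono_left
      nhdsWithin_le_nhds
  rw [mul_zero, add_zero] at h1
  exact ge_of_tendsto h1 (eventually_mem_nhdsWithin.mono h)

variable {X : Type*} [MetricSpace X] [MeasurableSpace X] {μ : Measure X} {E : Set X} {R q : ℝ}

theorem exists_cover_of_hausdorffContentCodim_eq_zero (h : hausdorffContentCodim μ R q E = 0)
    {τ : ℝ≥0∞} (hτ : 0 < τ) : ∃ S : Set (X × ℝ), S.Countable ∧ (∀ b ∈ S, 0 < b.2 ∧ b.2 ≤ R) ∧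
      E ⊆ ⋃ b ∈ S, closedBall b.1 b.2 ∧
      ∑' b : S, ENNReal.ofReal b.1.2 ^ (-q) * μ (closedBall b.1.1 b.1.2) < τ := by
  rw [← h, hausdorffContentCodim] at hτ
  simp only [iInf_lt_iff, exists_prop] at hτ
  exact hτ

theorem rpow_neg_le_mul_rpow_neg {r q' : ℝ} (hr : 0 < r) (hrR : r ≤ R) (hq : q ≤ q') :
    ENNReal.ofReal r ^ (-q) ≤ ENNReal.ofReal (R ^ (q' - q)) * ENNReal.ofReal r ^ (-q') := by
  rw [ENNReal.ofReal_rpow_of_pos hr, ENNReal.ofReal_rpow_of_pos hr,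
    ← ENNReal.ofReal_mul (Real.rpow_nonneg (hr.le.trans hrR) _)]
  refine ENNReal.ofReal_le_ofReal ?_
  calc r ^ (-q) = r ^ (q' - q) * r ^ (-q') := by rw [← Real.rpow_add hr]; ring_nf
    _ ≤ _ := by
      have : 0 ≤ q' - q := sub_nonneg.2 hq
      gcongr

/-- The radii are at most `R`, so `r ^ (-q)` is at most a constant times `r ^ (-q')`. -/
theorem hausdorffContentCodim_eq_zero_of_le {q' : ℝ} (hq : q ≤ q')
    (h : hausdorffContentCodim μ R q' E = 0) : hausdorffContentCodim μ R q E = 0 := by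
  refine le_antisymm (ENNReal.le_of_forall_le_add_mul (Z := ENNReal.ofReal (R ^ (q' - q)))
    ENNReal.ofReal_ne_top fun τ hτ => ?_) bot_le
  obtain ⟨S, hS, hr, hE, hsum⟩ := exists_cover_of_hausdorffContentCodim_eq_zero h hτ
  rw [zero_add, hausdorffContentCodim]
  refine le_trans (iInf_le_of_le S (iInf_le_of_le hS (iInf_le_of_le hr (iInf_le _ hE)))) ?_
  calc _ ≤ ∑' b : S, ENNReal.ofReal (R ^ (q' - q)) *
        (ENNReal.ofReal b.1.2 ^ (-q') * μ (closedBall b.1.1 b.1.2)) := by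
        refine ENNReal.tsum_le_tsum fun b => ?_
        rw [← mul_assoc]
        gcongr
        exact rpow_neg_le_mul_rpow_neg (hr b b.2).1 (hr b b.2).2 hq
    _ ≤ _ := by
        rw [ENNReal.tsum_mul_left]
        gcongr

theorem measure_eq_zero_of_hausdorffContentCodim_eq_zero (hq : 0 ≤ q)
    (h : hausdorffContentCodim μ R q E = 0) : μ E = 0 := by
  have h0 := hausdorffContentCodim_eq_zero_of_le hq h
  refine le_antisymm (ENNReal.le_of_forall_le_add_mul ENNReal.one_ne_top fun τ hτ => ?_) bot_le
  obtain ⟨S, hS, -, hE, hsum⟩ := exists_cover_of_hausdorffContentCodim_eq_zero h0 hτ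
  rw [zero_add, one_mul]
  refine (measure_mono hE).trans ((measure_biUnion_le μ hS _).trans (le_trans ?_ hsum.le))
  simp

/-- Doubling the radii makes the balls open for compactness; balls missing `E` are discarded, so
that distances to `E` are controlled by the radii. -/
theorem exists_finite_cover_of_hausdorffContentCodim_eq_zero
    (h : hausdorffContentCodim μ R q E = 0) {A : Set X} (hA : IsCompact A) (hAE : A ⊆ E)
    {τ : ℝ≥0∞} (hτ : 0 < τ) :
    ∃ T : Finset (X × ℝ), (∀ b ∈ T, 0 < b.2 ∧ b.2 ≤ R) ∧ A ⊆ ⋃ b ∈ T, ball b.1 (2 * b.2) ∧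
      (∀ b ∈ T, (closedBall b.1 b.2 ∩ E).Nonempty) ∧
      ∑ b ∈ T, ENNReal.ofReal (b.2 ^ (-q)) * μ (closedBall b.1 b.2) ≤ τ := by
  obtain ⟨S, hS, hr, hE, hsum⟩ := exists_cover_of_hausdorffContentCodim_eq_zero h hτ
  obtain ⟨T, hTS, hTf, hAT⟩ := hA.elim_finite_subcover_image
    (b := {b ∈ S | (closedBall b.1 b.2 ∩ E).Nonempty}) (c := fun b => ball b.1 (2 * b.2))
    (fun _ _ => isOpen_ball) fun y hy => by
      obtain ⟨b, hbS, hyb⟩ := mem_iUnion₂.1 (hE (hAE hy))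
      exact mem_iUnion₂.2 ⟨b, ⟨hbS, y, hyb, hAE hy⟩,
        closedBall_subset_ball (by linarith [(hr b hbS).1]) hyb⟩
  lift T to Finset (X × ℝ) using hTf
  refine ⟨T, fun b hb => hr b (hTS hb).1, hAT, fun b hb => (hTS hb).2, le_trans ?_ hsum.le⟩
  have h1 : ∑ b ∈ T, ENNReal.ofReal (b.2 ^ (-q)) * μ (closedBall b.1 b.2) =
      ∑ b ∈ T, ENNReal.ofReal b.2 ^ (-q) * μ (closedBall b.1 b.2) :=
    Finset.sum_congr rfl fun b hb => by rw [ENNReal.ofReal_rpow_of_pos (hr b (hTS hb).1).1]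
  rw [h1, ← Finset.tsum_subtype' T
    (fun b : X × ℝ => ENNReal.ofReal b.2 ^ (-q) * μ (closedBall b.1 b.2))]
  exact ENNReal.tsum_mono_subtype
    (fun b : X × ℝ => ENNReal.ofReal b.2 ^ (-q) * μ (closedBall b.1 b.2)) fun b hb => (hTS hb).1

variable [BorelSpace X] [CompleteSpace X] {Ω : Set X} {p s a : ℝ} {C CD : ℝ≥0}

/-- Both cover terms, the cutoff energy and the measure of the removed balls, are at most a finite
constant times `τ`. That constant depends on `t` but not on the cover, so `τ` can tend to `0`. -/
theorem HardyInequalityWith.measure_layer_le (hp : 1 ≤ p) (hs : 0 < s) (ha : 0 < a)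
    (hC : C * (((p + s) / p) ^ p * (2 * a) ^ p) ≤ 1 / 2) (had : a * (p + s) ≤ p)
    (has : a * (p + s) ≤ s) (hμ : IsDoublingWith μ CD) (hH : HardyInequalityWith μ Ω p (p - s) C)
    (hΩ : IsOpen Ω) {R₀ : ℝ}
    (h0 : hausdorffContentCodim μ R₀ (s - a * (p + s)) Ωᶜ = 0)
    {x : X} (hx : x ∈ Ωᶜ) {R r t : ℝ} (hR : 0 < R) (ht : 0 < t) :
    ENNReal.ofReal (r ^ (-(s + a * (p + s)))) *
      μ ({y | t ≤ infDist y Ωᶜ ∧ infDist y Ωᶜ < r} ∩ closedBall x R) ≤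
    ENNReal.ofReal (2 * (C * (((p + s) / p) ^ p * (2 ^ p * a ^ (-s))))) *
      (ENNReal.ofReal (2 ^ (p + s) * 2 ^ (p - a * (p + s)) * R ^ (-(s + a * (p + s)))) *
          μ (closedBall x (2 * R))) := by
  have := hμ.properSpace
  have := hμ.isFiniteMeasureOnCompacts
  set k₁ := ENNReal.ofReal (2 * (C * (((p + s) / p) ^ p * (2 ^ p * a ^ (-s)))))
  set k₂ := ENNReal.ofReal (2 ^ (p + s) * 2 ^ (p - a * (p + s)) * R ^ (-(s + a * (p + s)))) *
          μ (closedBall x (2 * R))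
  set k₃ := ENNReal.ofReal (r ^ (-(s + a * (p + s))))
  set k₄ : ℝ := 2 ^ (p + s) * (t ^ (-(2 * (a * (p + s)))) * 4 ^ (p + a * (p + s))) with hk₄
  set q := s - a * (p + s) with hq
  have hq0 : 0 ≤ q := sub_nonneg.2 has
  set A := {y | t ≤ infDist y Ωᶜ ∧ infDist y Ωᶜ < r} ∩ closedBall x R
  refine ENNReal.le_of_forall_le_add_mul
    (Z := k₁ * (ENNReal.ofReal k₄ * (CD : ℝ≥0∞) ^ 2) +
      k₃ * ((CD : ℝ≥0∞) ^ 2 * ENNReal.ofReal (R₀ ^ q)))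
    (ENNReal.add_ne_top.2 ⟨?_, ?_⟩) fun τ hτ => ?_
  · exact ENNReal.mul_ne_top ENNReal.ofReal_ne_top (ENNReal.mul_ne_top ENNReal.ofReal_ne_top
      (ENNReal.pow_ne_top ENNReal.coe_ne_top))
  · exact ENNReal.mul_ne_top ENNReal.ofReal_ne_top (ENNReal.mul_ne_top
      (ENNReal.pow_ne_top ENNReal.coe_ne_top) ENNReal.ofReal_ne_top)
  obtain ⟨T, hT, hcov, hmeet, hsum⟩ := exists_finite_cover_of_hausdorffContentCodim_eq_zero h0
    ((isCompact_closedBall x (2 * R)).inter_left hΩ.isClosed_compl) inter_subset_left hτ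
  have key := hH.measure_layer_le_of_cover hp hs ha hC had hΩ hx (r := r) hR ht
    (fun b hb => (hT b hb).1) hcov hmeet
  have h3 : ∑ b ∈ T, ENNReal.ofReal (k₄ * b.2 ^ (-q)) * μ (closedBall b.1 (3 * b.2)) ≤
      ENNReal.ofReal k₄ * (CD : ℝ≥0∞) ^ 2 * τ := by
    calc ∑ b ∈ T, ENNReal.ofReal (k₄ * b.2 ^ (-q)) * μ (closedBall b.1 (3 * b.2))
        ≤ ∑ b ∈ T, ENNReal.ofReal k₄ * (CD : ℝ≥0∞) ^ 2 *
          (ENNReal.ofReal (b.2 ^ (-q)) * μ (closedBall b.1 b.2)) := by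
          refine Finset.sum_le_sum fun b hb => ?_
          rw [ENNReal.ofReal_mul (by positivity)]
          calc _ ≤ ENNReal.ofReal k₄ * ENNReal.ofReal (b.2 ^ (-q)) *
                ((CD : ℝ≥0∞) ^ 2 * μ (closedBall b.1 b.2)) := by
                gcongr
                exact hμ.measure_closedBall_three_mul_le b.1 (hT b hb).1
            _ = _ := by ring
      _ ≤ _ := by
          rw [← Finset.mul_sum]
          gcongr
  have h4 : μ (⋃ b ∈ T, closedBall b.1 (3 * b.2)) ≤
      (CD : ℝ≥0∞) ^ 2 * ENNReal.ofReal (R₀ ^ q) * τ := by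
    calc μ (⋃ b ∈ T, closedBall b.1 (3 * b.2)) ≤ ∑ b ∈ T, μ (closedBall b.1 (3 * b.2)) :=
          measure_biUnion_finset_le _ _
      _ ≤ ∑ b ∈ T, (CD : ℝ≥0∞) ^ 2 * ENNReal.ofReal (R₀ ^ q) *
          (ENNReal.ofReal (b.2 ^ (-q)) * μ (closedBall b.1 b.2)) := by
          refine Finset.sum_le_sum fun b hb => ?_
          have h5 := rpow_neg_le_mul_rpow_neg (hT b hb).1 (hT b hb).2 hq0
          rw [neg_zero, ENNReal.rpow_zero, sub_zero, ENNReal.ofReal_rpow_of_pos (hT b hb).1] at h5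
          calc μ (closedBall b.1 (3 * b.2)) ≤ (CD : ℝ≥0∞) ^ 2 * (1 * μ (closedBall b.1 b.2)) := by
                rw [one_mul]
                exact hμ.measure_closedBall_three_mul_le b.1 (hT b hb).1
            _ ≤ (CD : ℝ≥0∞) ^ 2 * (ENNReal.ofReal (R₀ ^ q) * ENNReal.ofReal (b.2 ^ (-q)) *
                μ (closedBall b.1 b.2)) := by gcongr
            _ = _ := by ring
      _ ≤ _ := by
          rw [← Finset.mul_sum]
          gcongr
  calc k₃ * μ A ≤ k₃ * (μ (A \ ⋃ b ∈ T, closedBall b.1 (3 * b.2)) +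
        μ (⋃ b ∈ T, closedBall b.1 (3 * b.2))) := by
        gcongr
        exact (measure_mono (by rw [sdiff_union_self]; exact subset_union_left)).trans
          (measure_union_le _ _)
    _ ≤ k₁ * (ENNReal.ofReal k₄ * (CD : ℝ≥0∞) ^ 2 * τ + k₂) +
        k₃ * ((CD : ℝ≥0∞) ^ 2 * ENNReal.ofReal (R₀ ^ q) * τ) := by
        rw [mul_add]
        refine add_le_add (key.trans ?_) (mul_le_mul_right h4 _)
        gcongr
    _ = _ := by ring

/-- The layer bound does not depend on `t`, so it passes to the increasing union as `t` decreases to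
`0`; the remaining part, `Ωᶜ`, is a null set. -/
theorem HardyInequalityWith.measure_thickening_le (hp : 1 ≤ p) (hs : 0 < s) (ha : 0 < a)
    (hC : C * (((p + s) / p) ^ p * (2 * a) ^ p) ≤ 1 / 2) (had : a * (p + s) ≤ p)
    (has : a * (p + s) ≤ s) (hμ : IsDoublingWith μ CD) (hH : HardyInequalityWith μ Ω p (p - s) C)
    (hΩ : IsOpen Ω) {R₀ : ℝ}
    (h0 : hausdorffContentCodim μ R₀ (s - a * (p + s)) Ωᶜ = 0)
    {x : X} (hx : x ∈ Ωᶜ) {R r : ℝ} (hR : 0 < R) (hr : 0 < r) :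
    μ (thickening r Ωᶜ ∩ closedBall x R) / μ (closedBall x R) ≤
      ENNReal.ofReal (2 * (C * (((p + s) / p) ^ p * (2 ^ p * a ^ (-s)))) *
        (2 ^ (p + s) * 2 ^ (p - a * (p + s))) * CD) *
        ENNReal.ofReal (r / R) ^ (s + a * (p + s)) := by
  have hne : Ωᶜ.Nonempty := ⟨x, hx⟩
  set e := s + a * (p + s)
  set k₁ : ℝ := 2 * (C * (((p + s) / p) ^ p * (2 ^ p * a ^ (-s))))
  have hk₁ : 0 ≤ k₁ := by positivity
  set k₂ : ℝ := 2 ^ (p + s) * 2 ^ (p - a * (p + s))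
  have hk₂ : 0 ≤ k₂ := by positivity
  set A : ℕ → Set X := fun n =>
    {y | 1 / ((n : ℝ) + 1) ≤ infDist y Ωᶜ ∧ infDist y Ωᶜ < r} ∩ closedBall x R
  have hmono : Monotone A := fun m n hmn y hy =>
    ⟨⟨(one_div_le_one_div_of_le (by positivity) (by gcongr)).trans hy.1.1, hy.1.2⟩, hy.2⟩
  have hA : ENNReal.ofReal (r ^ (-e)) * μ (⋃ n, A n) ≤
      ENNReal.ofReal k₁ * (ENNReal.ofReal (k₂ * R ^ (-e)) * μ (closedBall x (2 * R))) := by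
    rw [hmono.measure_iUnion, ENNReal.mul_iSup]
    exact iSup_le fun n => hH.measure_layer_le hp hs ha hC had has hμ hΩ h0 hx hR
      (by positivity)
  have hsub : thickening r Ωᶜ ∩ closedBall x R ⊆ Ωᶜ ∪ ⋃ n, A n := by
    rintro y ⟨hyr, hyB⟩
    by_cases hy : y ∈ Ωᶜ
    · exact Or.inl hy
    · obtain ⟨n, hn⟩ := exists_nat_one_div_lt
        ((hΩ.isClosed_compl.notMem_iff_infDist_pos hne).1 hy)
      have hlt : infDist y Ωᶜ < r := by
        rw [thickening, mem_ofPred_eq, ofReal_infDist hne,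
          ENNReal.ofReal_lt_ofReal_iff hr] at hyr
        exact hyr
      exact Or.inr (mem_iUnion.2 ⟨n, ⟨hn.le, hlt⟩, hyB⟩)
  have hle : μ (thickening r Ωᶜ ∩ closedBall x R) ≤ μ (⋃ n, A n) := by
    refine (measure_mono hsub).trans ((measure_union_le _ _).trans ?_)
    rw [measure_eq_zero_of_hausdorffContentCodim_eq_zero (sub_nonneg.2 has) h0, zero_add]
  refine ENNReal.div_le_of_le_mul (hle.trans ?_)
  have hre : ENNReal.ofReal (r ^ e) * ENNReal.ofReal (r ^ (-e)) = 1 := by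
    rw [← ENNReal.ofReal_mul (by positivity), ← Real.rpow_add hr]
    simp
  clear_value k₁ k₂ e
  calc μ (⋃ n, A n) = ENNReal.ofReal (r ^ e) * (ENNReal.ofReal (r ^ (-e)) * μ (⋃ n, A n)) := by
        rw [← mul_assoc, hre, one_mul]
    _ ≤ ENNReal.ofReal (r ^ e) * (ENNReal.ofReal k₁ *
        (ENNReal.ofReal (k₂ * R ^ (-e)) * (CD * μ (closedBall x R)))) := by
        refine mul_le_mul_right (hA.trans ?_) _
        gcongr
        exact hμ.doubling x R hR
    _ = _ := by
        rw [ENNReal.ofReal_rpow_of_pos (by positivity), Real.div_rpow hr.le hR.le, div_eq_mul_inv,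
          ← Real.rpow_neg hR.le, ENNReal.ofReal_mul hk₂, ENNReal.ofReal_mul (by positivity),
          ENNReal.ofReal_mul hk₁, ENNReal.ofReal_mul (by positivity), ENNReal.ofReal_coe_nnreal]
        ring

theorem HardyInequalityWith.le_lowerAssouadCodim (hp : 1 ≤ p) (hs : 0 < s) (ha : 0 < a)
    (hC : C * (((p + s) / p) ^ p * (2 * a) ^ p) ≤ 1 / 2) (had : a * (p + s) ≤ p)
    (has : a * (p + s) ≤ s) (hμ : IsDoublingWith μ CD) (hH : HardyInequalityWith μ Ω p (p - s) C)
    (hΩ : IsOpen Ω) {R₀ : ℝ}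
    (h0 : hausdorffContentCodim μ R₀ (s - a * (p + s)) Ωᶜ = 0) :
    ENNReal.ofReal (s + a * (p + s)) ≤ lowerAssouadCodim μ Ωᶜ := by
  refine le_iSup₂_of_le (s + a * (p + s)).toNNReal ⟨Real.toNNReal
    (2 * (C * (((p + s) / p) ^ p * (2 ^ p * a ^ (-s)))) *
      (2 ^ (p + s) * 2 ^ (p - a * (p + s))) * CD), fun x hx r R hr hrR _ => ?_⟩ le_rfl
  rw [Real.coe_toNNReal _ (by positivity)]
  exact hH.measure_thickening_le hp hs ha hC had has hμ hΩ h0 hx (hr.trans hrR) hr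

/-- The conditions serve, in order, for absorption, for the monotonicity of `d ^ (p - δ)` and for a
positive codimension `s - δ`. -/
theorem exists_pos_small_constant (C : ℝ≥0) {p s : ℝ} (hp : 1 ≤ p) (hs : 0 < s) :
    ∃ a : ℝ, 0 < a ∧ C * (((p + s) / p) ^ p * (2 * a) ^ p) ≤ 1 / 2 ∧ a * (p + s) ≤ p ∧
      a * (p + s) < s := by
  have h1 : Tendsto (fun a : ℝ => (C : ℝ) * (((p + s) / p) ^ p * (2 * a) ^ p)) (𝓝[>] 0)
      (𝓝 (C * (((p + s) / p) ^ p * (2 * 0) ^ p))) := by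
    refine Tendsto.mono_left (Continuous.tendsto ?_ 0) nhdsWithin_le_nhds
    exact continuous_const.mul (continuous_const.mul
      ((continuous_const.mul continuous_id).rpow_const fun _ => Or.inr (by linarith)))
  have h2 : Tendsto (fun a : ℝ => a * (p + s)) (𝓝[>] 0) (𝓝 (0 * (p + s))) :=
    (Continuous.tendsto (by fun_prop) 0).mono_left nhdsWithin_le_nhds
  rw [mul_zero, Real.zero_rpow (by linarith), mul_zero, mul_zero] at h1
  rw [zero_mul] at h2
  obtain ⟨a, ha, h3, h4, h5⟩ := (eventually_mem_nhdsWithin.and ((h1.eventually_le_const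
    (show (0 : ℝ) < 1 / 2 by norm_num)).and ((h2.eventually_le_const
    (show 0 < p by linarith)).and (h2.eventually_lt_const hs)))).exists
  exact ⟨a, ha, h3, h4, h5⟩

end Codimension

/-! ### The main theorem. -/

/-- The constant `ε` depends only on `p`, `β`, the doubling constant `CD` and the constant `CH` in
the Hardy inequality. -/
theorem theorem6p1 (p β : ℝ) (hp : 1 ≤ p) (hβ : β ≠ p) (CD CH : ℝ≥0) :
    ∃ ε : ℝ, 0 < ε ∧
      ∀ (X : Type*) [MetricSpace X] [CompleteSpace X] [MeasurableSpace X] [BorelSpace X]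
        (μ : Measure X) (Ω : Set X),
        IsDoublingWith μ CD → IsOpen Ω → HardyInequalityWith μ Ω p β CH →
        ∀ R : ℝ, 0 < R →
          ((hausdorffCodim μ R Ωᶜ : EReal) < ((p - β - ε : ℝ) : EReal) ∨
            ((p - β + ε : ℝ) : EReal) < (lowerAssouadCodim μ Ωᶜ : EReal)) ∧
          ((hausdorffCodim μ R Ωᶜ : EReal) < ((p - β : ℝ) : EReal) ∨
            ((p - β : ℝ) : EReal) < (lowerAssouadCodim μ Ωᶜ : EReal)) := by
  suffices h : ∃ ε : ℝ, 0 < ε ∧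
      ∀ (X : Type _) [MetricSpace X] [CompleteSpace X] [MeasurableSpace X] [BorelSpace X]
        (μ : Measure X) (Ω : Set X),
        IsDoublingWith μ CD → IsOpen Ω → HardyInequalityWith μ Ω p β CH →
        ∀ R : ℝ, (hausdorffCodim μ R Ωᶜ : EReal) < ((p - β - ε : ℝ) : EReal) ∨
            ((p - β + ε : ℝ) : EReal) < (lowerAssouadCodim μ Ωᶜ : EReal) by
    obtain ⟨ε, hε, h⟩ := h
    refine ⟨ε, hε, fun X _ _ _ _ μ Ω hμ hΩ hH R _ => ⟨h X μ Ω hμ hΩ hH R, ?_⟩⟩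
    refine (h X μ Ω hμ hΩ hH R).imp (fun h => h.trans_le ?_) (fun h => lt_of_le_of_lt ?_ h)
    · exact EReal.coe_le_coe_iff.2 (by linarith)
    · exact EReal.coe_le_coe_iff.2 (by linarith)
  rcases lt_or_gt_of_ne hβ with hlt | hgt
  · have hs : 0 < p - β := sub_pos.2 hlt
    obtain ⟨a, ha, hC, had, has⟩ := exists_pos_small_constant CH hp hs
    set δ := a * (p + (p - β)) with hδ
    have hδ0 : 0 < δ := mul_pos ha (by linarith)
    -- Halving `δ` leaves room on both sides: codimension at least `s - δ / 2` yields an admissible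
    -- exponent above `s - δ`, and `s + δ` strictly exceeds `s + δ / 2`.
    refine ⟨δ / 2, by linarith, fun X _ _ _ _ μ Ω hμ hΩ hH R => ?_⟩
    rw [or_iff_not_imp_left, not_lt]
    intro hcodim
    have h1 : ENNReal.ofReal (p - β - δ) < hausdorffCodim μ R Ωᶜ := by
      rw [← EReal.coe_ennreal_lt_coe_ennreal_iff, EReal.coe_ennreal_ofReal,
        max_eq_left (by linarith)]
      exact lt_of_lt_of_le (EReal.coe_lt_coe_iff.2 (by linarith)) hcodim
    rw [hausdorffCodim] at h1
    simp only [lt_iSup_iff] at h1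
    obtain ⟨q, hq0, hq⟩ := h1
    rw [← ENNReal.ofReal_coe_nnreal, ENNReal.ofReal_lt_ofReal_iff_of_nonneg (by linarith)] at hq
    have h2 := HardyInequalityWith.le_lowerAssouadCodim hp hs ha hC had has.le hμ
      (by rwa [sub_sub_cancel]) hΩ (hausdorffContentCodim_eq_zero_of_le hq.le hq0)
    rw [← EReal.coe_ennreal_le_coe_ennreal_iff, EReal.coe_ennreal_ofReal,
      max_eq_left (by linarith)] at h2
    exact lt_of_lt_of_le (EReal.coe_lt_coe_iff.2 (by linarith)) h2
  -- Here `p - β + ε` is negative, while the Assouad codimension is nonnegative.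
  · refine ⟨(β - p) / 2, by linarith, fun X _ _ _ _ μ Ω _ _ _ R => Or.inr ?_⟩
    exact lt_of_lt_of_le (EReal.coe_lt_coe_iff.2 (show _ < (0 : ℝ) by linarith))
      (EReal.coe_ennreal_nonneg _)
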